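/- Let $(x_i,z_i,y_i)\in\mathbb R^{d_\beta}\times\mathbb R^{d_g}\times\mathbb R$, $i\ge 1$, with $d_\beta\le d_g<\infty$, be i.i.d. Let $n_0\ge 1$ be fixed and let $\mathbb S_0=\{(x_{0j},z_{0j},y_{0j})\}_{j=1}^{n_0}$ be a further i.i.d. sample from the same distribution, independent of $(x_i,z_i,y_i)_{i\ge1}$. Write $G_i=z_ix_i'$, $g_i(\beta)=z_i(x_i'\beta-y_i)$ and $G=\mathbb E[G_i]$. Assume: - $\mathbb E\|z_i\|^2<\infty$, and $G'G$ and $\mathbb E[z_iz_i']$ are positive definite; - $\beta_*\in\mathbb R^{d_\beta}$ is the unique solution of $\mathbb E[g_i(\beta)]=0$; - $\gamma_i=\gamma_0 i^{-a}$ with $\gamma_0>0$ and $a\in(1/2,1)$; - $\mathbb E\|G_i\|^2<\infty$ and $\mathbb E\|g_i(\beta_*)\|^2<\infty$. Let $\eta_0\ge 0$ be a constant; if $\eta_0=0$, assume that $\sum_{j=1}^{n_0}z_{0j}z_{0j}'$ is almost surely invertible. Let $\beta_0$ be any (measurable) function of $\mathbb S_0$, put $\bar\beta_0=\beta_0$,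 $\Phi_0=\frac1{n_0}\sum_{j=1}^{n_0} z_{0j}x_{0j}'$, $W_0=\bigl(\frac1{n_0}\sum_{j=1}^{n_0} z_{0j}z_{0j}'+\eta_0 I\bigr)^{-1}$, and for $i\ge1$ define (the S2SLS algorithm) $$\beta_i=\beta_{i-1}-\gamma_i(\Phi_{i-1}'W_{i-1}\Phi_{i-1})^{\dagger}\Phi_{i-1}'W_{i-1}\,g_i(\beta_{i-1}),\qquad \Phi_i=\tfrac{n_0+i-1}{n_0+i}\Phi_{i-1}+\tfrac1{n_0+i}G_i,$$ $$m_i=n_0+i-1+z_i'W_{i-1}z_i,\qquad W_i=\tfrac{n_0+i}{n_0+i-1}W_{i-1}\bigl[I-m_i^{-1}z_iz_i'W_{i-1}\bigr],\qquad \bar\beta_i=\tfrac{i-1}{i}\bar\beta_{i-1}+\tfrac1i\beta_i,$$ where $A^{\dagger}$ is the Moore–Penrose inverse of $A$. Then, as $n\to\infty$, $$\sqrt n\,(\bar\beta_n-\beta_*)\ \overset{d}{\to}\ N\bigl(0,\ (G'WG)^{-1}G'W\Omega WG(G'WG)^{-1}\bigr),$$ where $W=(\mathbb E[z_iz_i'])^{-1}$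 and $\Omega=\operatorname{var}(g_i(\beta_*))$. -/

import Mathlib

open MeasureTheory ProbabilityTheory Filter Topology
open scoped Matrix Matrix.Norms.L2Operator

noncomputable section

namespace S2SLS

/-! ### The generalized (Moore–Penrose) inverse of a real matrix -/

/-- The four Penrose equations: `B` is the Moore–Penrose inverse of `A`. -/
structure IsMoorePenrose {m n : ℕ} (A : Matrix (Fin m) (Fin n) ℝ)
    (B : Matrix (Fin n) (Fin m) ℝ) : Prop where
  mul_mul_left : A * B * A = A
  mul_mul_right : B * A * B = B
  symm_left : (A * B)ᵀ = A * B
  symm_right : (B * A)ᵀ = B * A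

/-- The Moore–Penrose inverse is unique. -/
theorem IsMoorePenrose.unique {m n : ℕ} {A : Matrix (Fin m) (Fin n) ℝ}
    {B C : Matrix (Fin n) (Fin m) ℝ} (hB : IsMoorePenrose A B) (hC : IsMoorePenrose A C) :
    B = C := by
  have hAB : A * B = A * C := by
    calc A * B = (A * C * A) * B := by rw [hC.mul_mul_left]
      _ = (A * C)ᵀ * (A * B)ᵀ := by rw [hC.symm_left, hB.symm_left, Matrix.mul_assoc]
      _ = (A * B * A * C)ᵀ := by
        rw [← Matrix.transpose_mul]; simp only [Matrix.mul_assoc]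
      _ = A * C := by rw [hB.mul_mul_left, hC.symm_left]
  have hBA : B * A = C * A := by
    calc B * A = B * (A * C * A) := by rw [hC.mul_mul_left]
      _ = (B * A)ᵀ * (C * A)ᵀ := by
        rw [hC.symm_right, hB.symm_right]; simp only [Matrix.mul_assoc]
      _ = (C * (A * B * A))ᵀ := by
        rw [← Matrix.transpose_mul]; simp only [Matrix.mul_assoc]
      _ = C * A := by rw [hB.mul_mul_left, hC.symm_right]
  calc B = B * A * B := hB.mul_mul_right.symm
    _ = C * (A * C) := by rw [hBA, Matrix.mul_assoc, hAB]
    _ = C := by rw [← Matrix.mul_assoc, hC.mul_mul_right]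

/-- Every symmetric real matrix `S` has a symmetric `T`, commuting with `S`, with `S T S = S` and
`T S T = T`. -/
theorem exists_symm_pinv {n : ℕ} {S : Matrix (Fin n) (Fin n) ℝ} (hS : S.IsHermitian) :
    ∃ T : Matrix (Fin n) (Fin n) ℝ, Tᵀ = T ∧ T * S = S * T ∧ S * T * S = S ∧ T * S * T = T := by
  set U : Matrix (Fin n) (Fin n) ℝ := (hS.eigenvectorUnitary : Matrix (Fin n) (Fin n) ℝ) with hU
  have hUU : Uᵀ * U = 1 := by
    have h := Unitary.coe_star_mul_self hS.eigenvectorUnitary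
    simpa [Matrix.star_eq_conjTranspose] using h
  have hspec : S = U * Matrix.diagonal hS.eigenvalues * Uᵀ := by
    have h := hS.spectral_theorem
    rw [Unitary.conjStarAlgAut_apply] at h
    simpa [Matrix.star_eq_conjTranspose, Function.comp_def] using h
  set L := hS.eigenvalues with hL
  have key : ∀ D E : Fin n → ℝ, (U * Matrix.diagonal D * Uᵀ) * (U * Matrix.diagonal E * Uᵀ)
      = U * Matrix.diagonal (fun i => D i * E i) * Uᵀ := by
    intro D E
    calc (U * Matrix.diagonal D * Uᵀ) * (U * Matrix.diagonal E * Uᵀ)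
        = U * Matrix.diagonal D * (Uᵀ * U) * Matrix.diagonal E * Uᵀ := by
          simp only [Matrix.mul_assoc]
      _ = _ := by
          rw [hUU, Matrix.mul_one, Matrix.mul_assoc U, Matrix.diagonal_mul_diagonal]
  refine ⟨U * Matrix.diagonal (fun i => (L i)⁻¹) * Uᵀ, ?_, ?_, ?_, ?_⟩
  · simp [Matrix.transpose_mul, Matrix.mul_assoc]
  · rw [hspec, key, key]; simp only [mul_comm]
  · rw [hspec, key, key]; simp only [mul_inv_mul_cancel]
  · rw [hspec, key, key]
    congr 3
    funext i
    by_cases h : L i = 0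
    · simp [h]
    · field_simp

/-- Every real matrix has a Moore–Penrose inverse. -/
theorem exists_isMoorePenrose {m n : ℕ} (A : Matrix (Fin m) (Fin n) ℝ) :
    ∃ B, IsMoorePenrose A B := by
  have hS : (Aᵀ * A).IsHermitian := by
    simpa using Matrix.isHermitian_conjTranspose_mul_self A
  obtain ⟨T, hT, hc, h1, h2⟩ := exists_symm_pinv hS
  have hA : A * T * (Aᵀ * A) = A := by
    have hz : (A * T * (Aᵀ * A) - A)ᵀ * (A * T * (Aᵀ * A) - A) = 0 := by
      have e : (A * T * (Aᵀ * A) - A) = A * (T * (Aᵀ * A) - 1) := by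
        rw [Matrix.mul_sub, Matrix.mul_one, Matrix.mul_assoc]
      have e2 : (Aᵀ * A) * (T * (Aᵀ * A) - 1) = 0 := by
        rw [Matrix.mul_sub, Matrix.mul_one, ← Matrix.mul_assoc, h1, sub_self]
      rw [e, Matrix.transpose_mul, Matrix.mul_assoc, ← Matrix.mul_assoc Aᵀ, e2, Matrix.mul_zero]
    have := Matrix.conjTranspose_mul_self_eq_zero.mp
      (by simpa using hz : (A * T * (Aᵀ * A) - A)ᴴ * (A * T * (Aᵀ * A) - A) = 0)
    exact sub_eq_zero.mp this
  refine ⟨T * Aᵀ, ?_, ?_, ?_, ?_⟩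
  · rw [← hA]; simp only [← Matrix.mul_assoc] at hA ⊢; simp only [hA]
  · calc T * Aᵀ * A * (T * Aᵀ) = (T * (Aᵀ * A) * T) * Aᵀ := by simp only [Matrix.mul_assoc]
      _ = _ := by rw [h2]
  · simp [Matrix.transpose_mul, hT, Matrix.mul_assoc]
  · rw [Matrix.mul_assoc, Matrix.transpose_mul, hT, Matrix.transpose_mul,
      Matrix.transpose_transpose, hc]

/-- The generalized inverse `A†`: the Moore–Penrose inverse of `A`. -/
def pinv {m n : ℕ} (A : Matrix (Fin m) (Fin n) ℝ) : Matrix (Fin n) (Fin m) ℝ :=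
  (exists_isMoorePenrose A).choose

theorem pinv_spec {m n : ℕ} (A : Matrix (Fin m) (Fin n) ℝ) : IsMoorePenrose A (pinv A) :=
  (exists_isMoorePenrose A).choose_spec

/-! ### The instrumental variables model -/

/-- An observation `(x, z, y)`: covariates, instruments and dependent variable. -/
abbrev Obs (dβ dg : ℕ) : Type :=
  EuclideanSpace ℝ (Fin dβ) × EuclideanSpace ℝ (Fin dg) × ℝ

variable {dβ dg : ℕ}

/-- The covariates `x`. -/
def Obs.x (D : Obs dβ dg) : EuclideanSpace ℝ (Fin dβ) := D.1

/-- The instruments `z`. -/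
def Obs.z (D : Obs dβ dg) : EuclideanSpace ℝ (Fin dg) := D.2.1

/-- The dependent variable `y`. -/
def Obs.y (D : Obs dβ dg) : ℝ := D.2.2

/-- The matrix `G_i = z x'` of an observation. -/
def Obs.G (D : Obs dβ dg) : Matrix (Fin dg) (Fin dβ) ℝ :=
  Matrix.vecMulVec D.z.ofLp D.x.ofLp

/-- The matrix `z z'` of an observation. -/
def Obs.zz (D : Obs dβ dg) : Matrix (Fin dg) (Fin dg) ℝ :=
  Matrix.vecMulVec D.z.ofLp D.z.ofLp

/-- The moment function `g_i(β) = z (x'β - y)` of an observation. -/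
def Obs.g (D : Obs dβ dg) (β : EuclideanSpace ℝ (Fin dβ)) : EuclideanSpace ℝ (Fin dg) :=
  (D.x.ofLp ⬝ᵥ β.ofLp - D.y) • D.z

/-- `G = E[z x']`, where `μ` is the population distribution of `(x, z, y)`. -/
def popG (μ : Measure (Obs dβ dg)) : Matrix (Fin dg) (Fin dβ) ℝ :=
  Matrix.of fun k l => ∫ D, D.G k l ∂μ

/-- `E[z z']`. -/
def popQ (μ : Measure (Obs dβ dg)) : Matrix (Fin dg) (Fin dg) ℝ :=
  Matrix.of fun k l => ∫ D, D.zz k l ∂μ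

/-- `W = (E[z z'])⁻¹`. -/
def popW (μ : Measure (Obs dβ dg)) : Matrix (Fin dg) (Fin dg) ℝ := (popQ μ)⁻¹

/-- `Ω = var(g_i(β))`, the covariance matrix of the moment function at `β`. -/
def popOmega (μ : Measure (Obs dβ dg)) (β : EuclideanSpace ℝ (Fin dβ)) :
    Matrix (Fin dg) (Fin dg) ℝ :=
  Matrix.of fun k l => cov[fun D => D.g β k, fun D => D.g β l; μ]

/-- `(G'WG)⁻¹ G'W Ω W G (G'WG)⁻¹`. -/
def avar (μ : Measure (Obs dβ dg)) (β : EuclideanSpace ℝ (Fin dβ)) :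
    Matrix (Fin dβ) (Fin dβ) ℝ :=
  ((popG μ)ᵀ * popW μ * popG μ)⁻¹ * (popG μ)ᵀ * popW μ * popOmega μ β * popW μ * popG μ *
    ((popG μ)ᵀ * popW μ * popG μ)⁻¹

/-! ### The algorithm -/

/-- The quadruple `(β_i, Φ_i, W_i, β̄_i)`. -/
structure State (dβ dg : ℕ) : Type where
  β : EuclideanSpace ℝ (Fin dβ)
  Φ : Matrix (Fin dg) (Fin dβ) ℝ
  W : Matrix (Fin dg) (Fin dg) ℝ
  βbar : EuclideanSpace ℝ (Fin dβ)

/-- `(1 / n₀) ∑ⱼ z₀ⱼ z₀ⱼ' + η₀ I`, whose inverse is `W₀`. -/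
def initQ {n₀ : ℕ} (η₀ : ℝ) (S₀ : Fin n₀ → Obs dβ dg) : Matrix (Fin dg) (Fin dg) ℝ :=
  (1 / (n₀ : ℝ)) • (∑ j, (S₀ j).zz) + η₀ • (1 : Matrix (Fin dg) (Fin dg) ℝ)

/-- The initial state, computed from the initialization sample `S₀` and the initial estimate
`β₀`. -/
def init {n₀ : ℕ} (η₀ : ℝ) (S₀ : Fin n₀ → Obs dβ dg) (β₀ : EuclideanSpace ℝ (Fin dβ)) :
    State dβ dg where
  β := β₀
  Φ := (1 / (n₀ : ℝ)) • (∑ j, (S₀ j).G)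
  W := (initQ η₀ S₀)⁻¹
  βbar := β₀

/-- The update of `β` in step `i` (learning rate `γ`, observation `D`, previous state `s`):
`β - γ (Φ'WΦ)† Φ'W g_i(β)`. -/
def stepβ (γ : ℝ) (D : Obs dβ dg) (s : State dβ dg) : EuclideanSpace ℝ (Fin dβ) :=
  s.β - γ • WithLp.toLp 2
    ((pinv (s.Φᵀ * s.W * s.Φ) * s.Φᵀ * s.W) *ᵥ (D.g s.β).ofLp)

/-- Step `i ≥ 1` of the algorithm, processing observation `D` from the previous state `s`. -/
def step (n₀ : ℕ) (γ₀ a : ℝ) (i : ℕ) (D : Obs dβ dg) (s : State dβ dg) : State dβ dg where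
  β := stepβ (γ₀ * (i : ℝ) ^ (-a)) D s
  Φ := (((n₀ : ℝ) + i - 1) / (n₀ + i)) • s.Φ + (1 / ((n₀ : ℝ) + i)) • D.G
  W :=
    let m : ℝ := (n₀ : ℝ) + i - 1 + D.z.ofLp ⬝ᵥ (s.W *ᵥ D.z.ofLp)
    (((n₀ : ℝ) + i) / (n₀ + i - 1)) • (s.W * (1 - m⁻¹ • (D.zz * s.W)))
  βbar := (((i : ℝ) - 1) / i) • s.βbar + (1 / (i : ℝ)) • stepβ (γ₀ * (i : ℝ) ^ (-a)) D s

/-- The state after `i` steps. The sample is a sequence indexed from `0`, so that `S k` is the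
observation with number `k + 1`, used in step `k + 1`. -/
def run {n₀ : ℕ} (η₀ γ₀ a : ℝ) (S₀ : Fin n₀ → Obs dβ dg) (β₀ : EuclideanSpace ℝ (Fin dβ))
    (S : ℕ → Obs dβ dg) : ℕ → State dβ dg
  | 0 => init η₀ S₀ β₀
  | k + 1 => step n₀ γ₀ a (k + 1) (S k) (run η₀ γ₀ a S₀ β₀ S k)

end S2SLS

end

/-! Since `g_i` is affine in `β` with slope `G_i`, the error `δ_k = β_k - β_*` obeys a linear
recursion `δ_{k+1} = δ_k - γ B_k (G_i δ_k + g_i(β_*))`, where `B_k = (Φ_k'W_kΦ_k)†Φ_k'W_k` depends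
on the past and the fresh observation is independent of it. By Sherman–Morrison, `W_k` is the
inverse of a running mean of `zz'` with a vanishing ridge term, so the law of large numbers gives
`B_k → B₀ = (G'WG)⁻¹G'W` almost surely, and `B₀G = I`. The mean drift is therefore close to `-γ
δ_k`, and `E‖δ_k‖² = O(γ_k)` (`IsScheme.lintegral_enorm_sq_le`).

Solving the recursion for `δ_k + B₀ g_i(β_*)` and summing by parts (`IsScheme.sum_eq`) leaves
boundary terms, increments of `1/γ`, a martingale whose increments have vanishing variance, and the
drift errors `(B_kG - I)δ_k`. All are `o(√n)` in `L¹` (`IsScheme.tendstoInMeasure`). For the drift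
errors, `B_kΦ_k = I` holds exactly once the Gram matrix is invertible, whatever `W_k` is. So `B_kG -
I = B_k(G - Φ_k)` has `L²` norm `O(k^{-1/2})`, and Cauchy–Schwarz against `δ_k` suffices. Only `Φ_k`
needs a rate; for `W_k` convergence is enough.

These moment bounds ask for bounded preconditioners, small learning rates and a bounded start, which
the algorithm has only eventually and with high probability. A modified scheme, started at a late
time, has them always and agrees with the algorithm on an event of probability near one
(`tendstoInMeasure_zero_of_localization`).

Hence `√n(β̄_n - β_*)` is `-n^{-1/2} ∑ B₀ g_i(β_*)` up to a term vanishing in probability. The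
central limit theorem gives the limit, with covariance `B₀ΩB₀'`, which is `avar`. -/

noncomputable section

namespace S2SLS

/-! ### Second moments of sums with a conditionally centered term -/

section SecondMoments

variable {Ω 𝓧 𝓨 H : Type*} [MeasurableSpace Ω] [MeasurableSpace 𝓧] [MeasurableSpace 𝓨]
  [NormedAddCommGroup H]

/-- The square of the extended norm. -/
theorem enorm_sq_eq_ofReal {H : Type*} [NormedAddCommGroup H] (v : H) :
    ‖v‖ₑ ^ 2 = ENNReal.ofReal (‖v‖ ^ 2) := by
  rw [← ofReal_norm, ENNReal.ofReal_pow (norm_nonneg _)]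

theorem lintegral_enorm_sq_eq_ofReal {ν : Measure 𝓨} {f : 𝓨 → H}
    (hf : MemLp f 2 ν) : ∫⁻ y, ‖f y‖ₑ ^ 2 ∂ν = ENNReal.ofReal (∫ y, ‖f y‖ ^ 2 ∂ν) := by
  have h : Integrable (fun y => ‖f y‖ ^ 2) ν := hf.integrable_norm_pow two_ne_zero
  rw [ofReal_integral_eq_lintegral_ofReal h (Eventually.of_forall fun _ => by positivity)]
  simp_rw [enorm_sq_eq_ofReal]

/-- The first moment is at most the root of the second moment. -/
theorem lintegral_enorm_le_ofReal_sqrt {P : Measure Ω} [IsProbabilityMeasure P]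
    [MeasurableSpace H] [OpensMeasurableSpace H] {X : Ω → H} (hX : AEMeasurable X P) {c : ℝ}
    (h : ∫⁻ ω, ‖X ω‖ₑ ^ 2 ∂P ≤ ENNReal.ofReal c) :
    ∫⁻ ω, ‖X ω‖ₑ ∂P ≤ ENNReal.ofReal (√c) := by
  have h1 := ENNReal.lintegral_mul_le_Lp_mul_Lq P Real.HolderConjugate.two_two
    hX.enorm (aemeasurable_const (b := (1 : ENNReal)))
  simp only [Pi.mul_apply, mul_one, ENNReal.rpow_two, one_pow, lintegral_const, measure_univ,
    ENNReal.one_rpow] at h1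
  refine h1.trans ?_
  rw [Real.sqrt_eq_rpow]
  rcases le_or_gt 0 c with hc | hc
  · rw [← ENNReal.ofReal_rpow_of_nonneg hc (by norm_num)]
    gcongr
  · rw [ENNReal.ofReal_of_nonpos hc.le] at h
    simp [le_antisymm h zero_le]

/-- Cauchy–Schwarz for products of first moments. -/
theorem lintegral_mul_le_ofReal_sqrt {P : Measure Ω} {f g : Ω → ENNReal}
    (hf : AEMeasurable f P) (hg : AEMeasurable g P) {c d : ℝ} (hc : 0 ≤ c) (hd : 0 ≤ d)
    (hfc : ∫⁻ ω, f ω ^ 2 ∂P ≤ ENNReal.ofReal c) (hgd : ∫⁻ ω, g ω ^ 2 ∂P ≤ ENNReal.ofReal d) :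
    ∫⁻ ω, f ω * g ω ∂P ≤ ENNReal.ofReal (√c * √d) := by
  have h1 := ENNReal.lintegral_mul_le_Lp_mul_Lq P Real.HolderConjugate.two_two hf hg
  simp only [Pi.mul_apply, ENNReal.rpow_two] at h1
  refine h1.trans ?_
  rw [Real.sqrt_eq_rpow, Real.sqrt_eq_rpow, ENNReal.ofReal_mul (by positivity),
    ← ENNReal.ofReal_rpow_of_nonneg hc (by norm_num),
    ← ENNReal.ofReal_rpow_of_nonneg hd (by norm_num)]
  gcongr

variable [InnerProductSpace ℝ H] [FiniteDimensional ℝ H]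

/-- Adding a constant to a centered random vector. -/
theorem lintegral_enorm_const_add_sq {ν : Measure 𝓨} [IsProbabilityMeasure ν] {f : 𝓨 → H}
    (hf : MemLp f 2 ν) (h0 : ∫ y, f y ∂ν = 0) (v : H) :
    ∫⁻ y, ‖v + f y‖ₑ ^ 2 ∂ν = ‖v‖ₑ ^ 2 + ∫⁻ y, ‖f y‖ₑ ^ 2 ∂ν := by
  have hi : Integrable f ν := hf.integrable one_le_two
  have h2 : Integrable (fun y => ‖f y‖ ^ 2) ν := hf.integrable_norm_pow two_ne_zero
  have h1 : Integrable (fun y => 2 * inner ℝ v (f y)) ν := (hi.const_inner v).const_mul 2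
  have hvf : MemLp (fun y => v + f y) 2 ν := (memLp_const v).add hf
  rw [lintegral_enorm_sq_eq_ofReal hvf, lintegral_enorm_sq_eq_ofReal hf,
    enorm_sq_eq_ofReal, ← ENNReal.ofReal_add (by positivity)
      (integral_nonneg fun _ => by positivity)]
  congr 1
  simp_rw [norm_add_sq_real]
  have hc : Integrable (fun _ : 𝓨 => ‖v‖ ^ 2) ν := integrable_const _
  have hc1 : Integrable (fun y => ‖v‖ ^ 2 + 2 * inner ℝ v (f y)) ν := hc.add h1
  rw [integral_add hc1 h2, integral_add hc h1,
    integral_const_mul, integral_inner hi, h0]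
  simp

/-- The second moment of a random vector plus a conditionally centered one. -/
theorem lintegral_enorm_add_sq_of_indep [MeasurableSpace H] [BorelSpace H] {P : Measure Ω} [IsProbabilityMeasure P]
    {X : Ω → 𝓧} {Y : Ω → 𝓨} (hX : Measurable X) (hY : Measurable Y) (hXY : IndepFun X Y P)
    {v : 𝓧 → H} (hv : Measurable v) {f : 𝓧 → 𝓨 → H} (hf : Measurable (Function.uncurry f))
    (hf2 : ∀ x, MemLp (f x) 2 (P.map Y)) (hf0 : ∀ x, ∫ y, f x y ∂(P.map Y) = 0) :
    ∫⁻ ω, ‖v (X ω) + f (X ω) (Y ω)‖ₑ ^ 2 ∂P =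
      ∫⁻ ω, ‖v (X ω)‖ₑ ^ 2 ∂P + ∫⁻ ω, ∫⁻ y, ‖f (X ω) y‖ₑ ^ 2 ∂(P.map Y) ∂P := by
  have : IsProbabilityMeasure (P.map Y) := Measure.isProbabilityMeasure_map hY.aemeasurable
  -- Under the product law, Fubini freezes the past, and the cross term vanishes pointwise in it; no
  -- conditional expectation is needed.
  have hmap := (indepFun_iff_map_prod_eq_prod_map_map hX.aemeasurable hY.aemeasurable).1 hXY
  have hm : Measurable fun p : 𝓧 × 𝓨 => ‖v p.1 + f p.1 p.2‖ₑ ^ 2 :=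
    ((hv.comp measurable_fst).add hf).enorm.pow_const 2
  have hm' : Measurable fun p : 𝓧 × 𝓨 => ‖f p.1 p.2‖ₑ ^ 2 := hf.enorm.pow_const 2
  calc ∫⁻ ω, ‖v (X ω) + f (X ω) (Y ω)‖ₑ ^ 2 ∂P
      = ∫⁻ p, ‖v p.1 + f p.1 p.2‖ₑ ^ 2 ∂(P.map fun ω => (X ω, Y ω)) :=
        (lintegral_map hm (hX.prodMk hY)).symm
    _ = ∫⁻ x, ∫⁻ y, ‖v x + f x y‖ₑ ^ 2 ∂(P.map Y) ∂(P.map X) := by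
        rw [hmap, lintegral_prod _ hm.aemeasurable]
    _ = ∫⁻ x, (‖v x‖ₑ ^ 2 + ∫⁻ y, ‖f x y‖ₑ ^ 2 ∂(P.map Y)) ∂(P.map X) := by
        simp_rw [lintegral_enorm_const_add_sq (hf2 _) (hf0 _)]
    _ = ∫⁻ ω, (‖v (X ω)‖ₑ ^ 2 + ∫⁻ y, ‖f (X ω) y‖ₑ ^ 2 ∂(P.map Y)) ∂P :=
        lintegral_map ((hv.enorm.pow_const 2).add hm'.lintegral_prod_right') hX
    _ = _ := lintegral_add_left ((hv.comp hX).enorm.pow_const 2) _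

end SecondMoments

/-! ### The noise of one step, with frozen coefficients -/

section Noise

variable {𝓨 E F : Type*} [MeasurableSpace 𝓨]
  [NormedAddCommGroup E] [InnerProductSpace ℝ E] [FiniteDimensional ℝ E]
  [NormedAddCommGroup F] [InnerProductSpace ℝ F] [FiniteDimensional ℝ F]

/-- The noise `B (T y - T₀) d + C (e y)` of a linear stochastic approximation step. -/
def noise (T : 𝓨 → E →L[ℝ] F) (T₀ : E →L[ℝ] F) (e : 𝓨 → F)
    (x : (F →L[ℝ] E) × (F →L[ℝ] E) × E) (y : 𝓨) : E :=
  x.1 ((T y - T₀) x.2.2) + x.2.1 (e y)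

variable {T : 𝓨 → E →L[ℝ] F} {T₀ : E →L[ℝ] F} {e : 𝓨 → F}

theorem measurable_noise [MeasurableSpace E] [BorelSpace E] [MeasurableSpace F] [BorelSpace F]
    (hT : Measurable T) (he : Measurable e) :
    Measurable (Function.uncurry (noise T T₀ e)) := by
  have h1 : Measurable fun p : ((F →L[ℝ] E) × (F →L[ℝ] E) × E) × 𝓨 => (T p.2 - T₀) p.1.2.2 :=
    ContinuousLinearMap.measurable_apply₂.comp
      (((hT.comp measurable_snd).sub_const T₀).prodMk measurable_fst.snd.snd)
  exact (ContinuousLinearMap.measurable_apply₂.comp (measurable_fst.fst.prodMk h1)).add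
    (ContinuousLinearMap.measurable_apply₂.comp
      (measurable_fst.snd.fst.prodMk (he.comp measurable_snd)))

variable {ν : Measure 𝓨} [IsProbabilityMeasure ν]

theorem memLp_noise (hT : MemLp T 2 ν) (he : MemLp e 2 ν)
    (x : (F →L[ℝ] E) × (F →L[ℝ] E) × E) : MemLp (noise T T₀ e x) 2 ν := by
  have h1 : MemLp (fun y => T y - T₀) 2 ν := hT.sub (memLp_const T₀)
  have h2 := (x.1 ∘L ContinuousLinearMap.apply ℝ F x.2.2).comp_memLp' h1
  exact h2.add (x.2.1.comp_memLp' he)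

/-- With the coefficients frozen, the noise is a continuous linear image of the centered variables
`T - T₀` and `e`. -/
theorem integral_noise (hT : MemLp T 2 ν) (he : MemLp e 2 ν) (hT₀ : ∫ y, T y ∂ν = T₀)
    (he₀ : ∫ y, e y ∂ν = 0) (x : (F →L[ℝ] E) × (F →L[ℝ] E) × E) :
    ∫ y, noise T T₀ e x y ∂ν = 0 := by
  have h1 : MemLp (fun y => T y - T₀) 2 ν := hT.sub (memLp_const T₀)
  have h1i := h1.integrable one_le_two
  have hei := he.integrable one_le_two
  have e1 := (x.1 ∘L ContinuousLinearMap.apply ℝ F x.2.2).integral_comp_comm h1i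
  have e2 := x.2.1.integral_comp_comm hei
  rw [integral_sub (hT.integrable one_le_two) (integrable_const _), hT₀] at e1
  rw [he₀] at e2
  have := integral_add ((x.1 ∘L ContinuousLinearMap.apply ℝ F x.2.2).integrable_comp h1i)
    (x.2.1.integrable_comp hei)
  rw [e1, e2] at this
  simpa [noise] using this

/-- Operator norm bounds and `(s + t)² ≤ 2(s² + t²)`. The two operators are kept apart because in
the martingale term the first is merely bounded, while the second is `B k - B₀` and tends to zero.
-/
theorem lintegral_noise_le (hT : MemLp T 2 ν) (he : MemLp e 2 ν)
    (x : (F →L[ℝ] E) × (F →L[ℝ] E) × E) :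
    ∫⁻ y, ‖noise T T₀ e x y‖ₑ ^ 2 ∂ν ≤ ENNReal.ofReal
      (2 * (‖x.1‖ ^ 2 * (∫ y, ‖T y - T₀‖ ^ 2 ∂ν) * ‖x.2.2‖ ^ 2
        + ‖x.2.1‖ ^ 2 * ∫ y, ‖e y‖ ^ 2 ∂ν)) := by
  have h1 : MemLp (fun y => T y - T₀) 2 ν := hT.sub (memLp_const T₀)
  have i1 := h1.integrable_norm_pow two_ne_zero
  have i2 := he.integrable_norm_pow two_ne_zero
  have hn := memLp_noise (T₀ := T₀) hT he x
  rw [lintegral_enorm_sq_eq_ofReal hn]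
  refine ENNReal.ofReal_le_ofReal ?_
  have j1 : Integrable (fun y => 2 * (‖x.1‖ ^ 2 * ‖x.2.2‖ ^ 2) * ‖T y - T₀‖ ^ 2) ν :=
    i1.const_mul _
  have j2 : Integrable (fun y => 2 * ‖x.2.1‖ ^ 2 * ‖e y‖ ^ 2) ν := i2.const_mul _
  calc ∫ y, ‖noise T T₀ e x y‖ ^ 2 ∂ν
      ≤ ∫ y, (2 * (‖x.1‖ ^ 2 * ‖x.2.2‖ ^ 2) * ‖T y - T₀‖ ^ 2
          + 2 * ‖x.2.1‖ ^ 2 * ‖e y‖ ^ 2) ∂ν := by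
        refine integral_mono (hn.integrable_norm_pow two_ne_zero) (j1.add j2) fun y => ?_
        have b1 : ‖x.1 ((T y - T₀) x.2.2)‖ ≤ ‖x.1‖ * (‖T y - T₀‖ * ‖x.2.2‖) :=
          (x.1.le_opNorm _).trans (by gcongr; exact ContinuousLinearMap.le_opNorm _ _)
        have b2 : ‖x.2.1 (e y)‖ ≤ ‖x.2.1‖ * ‖e y‖ := x.2.1.le_opNorm _
        have b3 : ‖noise T T₀ e x y‖ ≤ ‖x.1‖ * (‖T y - T₀‖ * ‖x.2.2‖) + ‖x.2.1‖ * ‖e y‖ :=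
          (norm_add_le _ _).trans (add_le_add b1 b2)
        calc ‖noise T T₀ e x y‖ ^ 2
            ≤ (‖x.1‖ * (‖T y - T₀‖ * ‖x.2.2‖) + ‖x.2.1‖ * ‖e y‖) ^ 2 := by gcongr
          _ ≤ 2 * ((‖x.1‖ * (‖T y - T₀‖ * ‖x.2.2‖)) ^ 2 + (‖x.2.1‖ * ‖e y‖) ^ 2) :=
            add_sq_le
          _ = _ := by ring
    _ = _ := by
        rw [integral_add j1 j2, integral_const_mul, integral_const_mul]
        ring

end Noise

/-! ### Mean square error of a linear stochastic approximation scheme -/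

section Scheme

variable {Ω 𝓨 E F : Type*} [MeasurableSpace Ω] [MeasurableSpace 𝓨]
  [NormedAddCommGroup E] [InnerProductSpace ℝ E] [FiniteDimensional ℝ E]
  [MeasurableSpace E] [BorelSpace E]
  [NormedAddCommGroup F] [InnerProductSpace ℝ F] [FiniteDimensional ℝ F]
  [MeasurableSpace F] [BorelSpace F]

/-- A preconditioned linear stochastic approximation scheme: at time `k` the error `δ k` is moved
by `-γ k • B k (T (Y k) (δ k) + e (Y k))`, where `B k` and `δ k` depend on the past `𝓕 k`, of which
the fresh observation `Y k` is independent. -/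
structure IsScheme (P : Measure Ω) (𝓕 : ℕ → MeasurableSpace Ω) (Y : ℕ → Ω → 𝓨) (ν : Measure 𝓨)
    (T : 𝓨 → E →L[ℝ] F) (T₀ : E →L[ℝ] F) (e : 𝓨 → F) (γ : ℕ → ℝ) (B : ℕ → Ω → F →L[ℝ] E)
    (δ : ℕ → Ω → E) : Prop where
  le : ∀ k, 𝓕 k ≤ ‹MeasurableSpace Ω›
  mono : Monotone 𝓕
  measurable_obs : ∀ k, Measurable[𝓕 (k + 1)] (Y k)
  law : ∀ k, P.map (Y k) = ν
  indep : ∀ k, Indep (𝓕 k) (MeasurableSpace.comap (Y k) inferInstance) P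
  measurable_T : Measurable T
  measurable_e : Measurable e
  memLp_T : MemLp T 2 ν
  memLp_e : MemLp e 2 ν
  integral_T : ∫ y, T y ∂ν = T₀
  integral_e : ∫ y, e y ∂ν = 0
  measurable_B : ∀ k, Measurable[𝓕 k] (B k)
  measurable_zero : Measurable[𝓕 0] (δ 0)
  step : ∀ k ω, δ (k + 1) ω = δ k ω - γ k • B k ω (T (Y k ω) (δ k ω) + e (Y k ω))

namespace IsScheme

variable {P : Measure Ω} {𝓕 : ℕ → MeasurableSpace Ω} {Y : ℕ → Ω → 𝓨} {ν : Measure 𝓨}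
  {T : 𝓨 → E →L[ℝ] F} {T₀ : E →L[ℝ] F} {e : 𝓨 → F} {γ : ℕ → ℝ} {B : ℕ → Ω → F →L[ℝ] E}
  {δ : ℕ → Ω → E}

theorem measurable_δ (h : IsScheme P 𝓕 Y ν T T₀ e γ B δ) (k : ℕ) : Measurable[𝓕 k] (δ k) := by
  induction k with
  | zero => exact h.measurable_zero
  | succ k ih =>
    have hm := h.mono k.le_succ
    have hδ : Measurable[𝓕 (k + 1)] (δ k) := ih.mono hm le_rfl
    have hB : Measurable[𝓕 (k + 1)] (B k) := (h.measurable_B k).mono hm le_rfl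
    have hY := h.measurable_obs k
    rw [show δ (k + 1) = fun ω => δ k ω - γ k • B k ω (T (Y k ω) (δ k ω) + e (Y k ω)) from
      funext (h.step k)]
    have h1 : Measurable[𝓕 (k + 1)] fun ω => T (Y k ω) (δ k ω) + e (Y k ω) :=
      (ContinuousLinearMap.measurable_apply₂.comp
        ((h.measurable_T.comp hY).prodMk hδ)).add (h.measurable_e.comp hY)
    exact hδ.sub ((ContinuousLinearMap.measurable_apply₂.comp (hB.prodMk h1)).const_smul (γ k))

/-- The second moment of a function of the past plus the noise of the present. -/
theorem lintegral_add_noise (h : IsScheme P 𝓕 Y ν T T₀ e γ B δ) [IsProbabilityMeasure P] (k : ℕ)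
    {V : Ω → E} (hV : Measurable[𝓕 k] V) {X : Ω → (F →L[ℝ] E) × (F →L[ℝ] E) × E}
    (hX : Measurable[𝓕 k] X) :
    ∫⁻ ω, ‖V ω + noise T T₀ e (X ω) (Y k ω)‖ₑ ^ 2 ∂P ≤ ∫⁻ ω, ‖V ω‖ₑ ^ 2 ∂P +
      ∫⁻ ω, ENNReal.ofReal (2 * (‖(X ω).1‖ ^ 2 * (∫ y, ‖T y - T₀‖ ^ 2 ∂ν) * ‖(X ω).2.2‖ ^ 2
        + ‖(X ω).2.1‖ ^ 2 * ∫ y, ‖e y‖ ^ 2 ∂ν)) ∂P := by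
  have hY : Measurable (Y k) := (h.measurable_obs k).mono (h.le _) le_rfl
  have hν : IsProbabilityMeasure ν := h.law k ▸ Measure.isProbabilityMeasure_map hY.aemeasurable
  -- Pairing `V` with the coefficients puts all that is used of the past into one variable
  -- independent of `Y k`.
  have hVX : Measurable[𝓕 k] fun ω => (V ω, X ω) := hV.prodMk hX
  have hind : IndepFun (fun ω => (V ω, X ω)) (Y k) P :=
    (IndepFun_iff_Indep _ _ _).2 (indep_of_indep_of_le_left (h.indep k) hVX.comap_le)
  have hmeas : Measurable (Function.uncurry fun (p : E × (F →L[ℝ] E) × (F →L[ℝ] E) × E) (y : 𝓨) =>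
      noise T T₀ e p.2 y) :=
    (measurable_noise h.measurable_T h.measurable_e).comp
      (measurable_fst.snd.prodMk measurable_snd)
  rw [lintegral_enorm_add_sq_of_indep (hVX.mono (h.le k) le_rfl) hY hind measurable_fst
    hmeas (fun p => by rw [h.law k]; exact memLp_noise h.memLp_T h.memLp_e p.2)
    (fun p => by rw [h.law k]; exact integral_noise h.memLp_T h.memLp_e h.integral_T h.integral_e _)]
  gcongr with ω
  rw [h.law k]
  exact lintegral_noise_le h.memLp_T h.memLp_e _

/-- The mean square error of the scheme is of the order of the learning rate. -/
theorem lintegral_enorm_sq_le (h : IsScheme P 𝓕 Y ν T T₀ e γ B δ) [IsProbabilityMeasure P]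
    {K C : ℝ} (hB : ∀ k ω, ‖B k ω‖ ≤ K) (hBT : ∀ k ω, ‖B k ω ∘L T₀ - .id ℝ E‖ ≤ 1 / 2)
    (hγ : ∀ k, 0 < γ k) (hγ1 : ∀ k, γ k ≤ 1) (hC : 0 ≤ C)
    (hγK : ∀ k, γ k * (1 / 4 + 2 * K ^ 2 * ∫ y, ‖T y - T₀‖ ^ 2 ∂ν) ≤ 1 / 4)
    (hγr : ∀ k, (γ (k + 1))⁻¹ - (γ k)⁻¹ ≤ 1 / 4)
    (hCe : 2 * K ^ 2 * ∫ y, ‖e y‖ ^ 2 ∂ν ≤ C / 4)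
    (h0 : ∀ ω, ‖δ 0 ω‖ ^ 2 ≤ C * γ 0) (k : ℕ) :
    ∫⁻ ω, ‖δ k ω‖ₑ ^ 2 ∂P ≤ ENNReal.ofReal (C * γ k) := by
  induction k with
  | zero =>
    calc ∫⁻ ω, ‖δ 0 ω‖ₑ ^ 2 ∂P ≤ ∫⁻ _, ENNReal.ofReal (C * γ 0) ∂P := by
          gcongr with ω
          rw [enorm_sq_eq_ofReal]
          exact ENNReal.ofReal_le_ofReal (h0 ω)
      _ = _ := by simp
  | succ k ih =>
    set τ := ∫ y, ‖T y - T₀‖ ^ 2 ∂ν with hτ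
    set σ := ∫ y, ‖e y‖ ^ 2 ∂ν with hσ
    have hτ0 : 0 ≤ τ := integral_nonneg fun _ => by positivity
    have hσ0 : 0 ≤ σ := integral_nonneg fun _ => by positivity
    have hδ := h.measurable_δ k
    have hBk := h.measurable_B k
    -- The step splits into its mean given the past and a noise with both operators equal to `-γ k •
    -- B k`.
    have hV : Measurable[𝓕 k] fun ω => δ k ω - γ k • B k ω (T₀ (δ k ω)) :=
      hδ.sub ((ContinuousLinearMap.measurable_apply₂.comp
        (hBk.prodMk (T₀.continuous.measurable.comp hδ))).const_smul (γ k))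
    have hX : Measurable[𝓕 k] fun ω => ((-γ k) • B k ω, (-γ k) • B k ω, δ k ω) :=
      (hBk.const_smul (-γ k)).prodMk ((hBk.const_smul (-γ k)).prodMk hδ)
    have hstep := h.lintegral_add_noise k hV hX
    have hrec : ∀ ω, δ (k + 1) ω = δ k ω - γ k • B k ω (T₀ (δ k ω)) +
        noise T T₀ e ((-γ k) • B k ω, (-γ k) • B k ω, δ k ω) (Y k ω) := by
      intro ω
      rw [h.step]
      simp only [noise, neg_smul, _root_.neg_apply, _root_.smul_apply,
        _root_.sub_apply, map_sub, map_add, smul_add]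
      abel
    simp_rw [← hrec] at hstep
    refine hstep.trans ?_
    have hg := hγ k
    have e1 : ∀ ω, ‖δ k ω - γ k • B k ω (T₀ (δ k ω))‖ₑ ^ 2 ≤
        ENNReal.ofReal ((1 - γ k / 2) ^ 2) * ‖δ k ω‖ₑ ^ 2 := by
      intro ω
      rw [enorm_sq_eq_ofReal, enorm_sq_eq_ofReal, ← ENNReal.ofReal_mul (by positivity), ← mul_pow]
      refine ENNReal.ofReal_le_ofReal ?_
      -- Since `B T₀` is within `1/2` of the identity, the drift contracts by `(1 - γ) + γ/2 = 1 -
      -- γ/2`.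
      have e2 : δ k ω - γ k • B k ω (T₀ (δ k ω)) =
          (1 - γ k) • δ k ω - γ k • (B k ω ∘L T₀ - .id ℝ E) (δ k ω) := by
        simp only [_root_.sub_apply, ContinuousLinearMap.comp_apply,
          ContinuousLinearMap.id_apply, sub_smul, one_smul, smul_sub]
        abel
      have e3 : ‖(B k ω ∘L T₀ - .id ℝ E) (δ k ω)‖ ≤ 1 / 2 * ‖δ k ω‖ :=
        ContinuousLinearMap.le_of_opNorm_le _ (hBT k ω) _
      have e4 : ‖δ k ω - γ k • B k ω (T₀ (δ k ω))‖ ≤ (1 - γ k / 2) * ‖δ k ω‖ := by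
        rw [e2]
        refine (norm_sub_le _ _).trans ?_
        rw [norm_smul, norm_smul, Real.norm_of_nonneg (sub_nonneg.2 (hγ1 k)),
          Real.norm_of_nonneg hg.le]
        nlinarith [norm_nonneg (δ k ω)]
      gcongr
    have e5 : ∀ ω, ENNReal.ofReal (2 * (‖(-γ k) • B k ω‖ ^ 2 * τ * ‖δ k ω‖ ^ 2
        + ‖(-γ k) • B k ω‖ ^ 2 * σ)) ≤
        ENNReal.ofReal (γ k ^ 2 * (2 * K ^ 2 * τ)) * ‖δ k ω‖ₑ ^ 2 +
          ENNReal.ofReal (γ k ^ 2 * (2 * K ^ 2 * σ)) := by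
      intro ω
      rw [enorm_sq_eq_ofReal, ← ENNReal.ofReal_mul (by positivity),
        ← ENNReal.ofReal_add (by positivity) (by positivity)]
      refine ENNReal.ofReal_le_ofReal ?_
      have e6 : ‖(-γ k) • B k ω‖ ^ 2 ≤ γ k ^ 2 * K ^ 2 := by
        rw [norm_smul, mul_pow, norm_neg, Real.norm_of_nonneg hg.le]
        gcongr
        exact hB k ω
      calc 2 * (‖(-γ k) • B k ω‖ ^ 2 * τ * ‖δ k ω‖ ^ 2 + ‖(-γ k) • B k ω‖ ^ 2 * σ)
          ≤ 2 * ((γ k ^ 2 * K ^ 2) * τ * ‖δ k ω‖ ^ 2 + (γ k ^ 2 * K ^ 2) * σ) := by gcongr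
        _ = _ := by ring
    have hδm : Measurable fun ω => ‖δ k ω‖ₑ ^ 2 :=
      (hδ.mono (h.le k) le_rfl).enorm.pow_const 2
    calc _ ≤ ∫⁻ ω, ENNReal.ofReal ((1 - γ k / 2) ^ 2) * ‖δ k ω‖ₑ ^ 2 ∂P +
          ∫⁻ ω, (ENNReal.ofReal (γ k ^ 2 * (2 * K ^ 2 * τ)) * ‖δ k ω‖ₑ ^ 2 +
          ENNReal.ofReal (γ k ^ 2 * (2 * K ^ 2 * σ))) ∂P :=
          add_le_add (lintegral_mono e1) (lintegral_mono e5)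
      _ = ENNReal.ofReal ((1 - γ k / 2) ^ 2) * ∫⁻ ω, ‖δ k ω‖ₑ ^ 2 ∂P +
          (ENNReal.ofReal (γ k ^ 2 * (2 * K ^ 2 * τ)) * ∫⁻ ω, ‖δ k ω‖ₑ ^ 2 ∂P +
          ENNReal.ofReal (γ k ^ 2 * (2 * K ^ 2 * σ))) := by
          rw [lintegral_add_right _ measurable_const, lintegral_const_mul _ hδm,
            lintegral_const_mul _ hδm]
          simp
      _ ≤ ENNReal.ofReal ((1 - γ k / 2) ^ 2) * ENNReal.ofReal (C * γ k) +
          (ENNReal.ofReal (γ k ^ 2 * (2 * K ^ 2 * τ)) * ENNReal.ofReal (C * γ k) +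
          ENNReal.ofReal (γ k ^ 2 * (2 * K ^ 2 * σ))) := by gcongr
      _ = ENNReal.ofReal ((1 - γ k / 2) ^ 2 * (C * γ k) +
          (γ k ^ 2 * (2 * K ^ 2 * τ) * (C * γ k) + γ k ^ 2 * (2 * K ^ 2 * σ))) := by
          rw [← ENNReal.ofReal_mul (by positivity), ← ENNReal.ofReal_mul (by positivity),
            ← ENNReal.ofReal_add (by positivity) (by positivity),
            ← ENNReal.ofReal_add (by positivity) (by positivity)]
      _ ≤ ENNReal.ofReal (C * γ (k + 1)) := by
          refine ENNReal.ofReal_le_ofReal ?_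
          have hg' := hγ (k + 1)
          -- The bound on the increments of `1/γ` says that `γ` decreases slowly enough for the
          -- contraction to keep up.
          have f1 : γ k * (1 - γ k / 4) ≤ γ (k + 1) := by
            have := hγr k
            have f2 : (γ (k + 1))⁻¹ ≤ (γ k)⁻¹ + 1 / 4 := by linarith
            have f3 : ((γ k)⁻¹ + 1 / 4)⁻¹ ≤ γ (k + 1) := by
              rw [← inv_inv (γ (k + 1))]
              exact inv_anti₀ (by positivity) f2
            refine le_trans ?_ f3
            rw [le_inv_comm₀ ?_ (by positivity)]
            · rw [mul_inv]
              have f5 : 0 < 1 - γ k / 4 := by linarith [hγ1 k]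
              have f4 : 1 + γ k / 4 ≤ (1 - γ k / 4)⁻¹ := by
                rw [le_inv_comm₀ (by positivity) f5, inv_eq_one_div, le_div_iff₀ (by positivity)]
                nlinarith
              calc (γ k)⁻¹ + 1 / 4 = (γ k)⁻¹ * (1 + γ k / 4) := by field_simp
                _ ≤ _ := by gcongr
            · exact mul_pos hg (by linarith [hγ1 k])
          -- In the expansion of `(1 - γ/2)²`, the `γ²/4` together with the multiplicative noise
          -- costs at most `Cγ²/4`, and the additive noise another `Cγ²/4`. What remains is `Cγ(1 -
          -- γ/2)`, which is at most `Cγ(1 - γ/4)`.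
          have f6 := mul_le_mul_of_nonneg_left (hγK k) (by positivity : 0 ≤ C * γ k ^ 2)
          have f7 := mul_le_mul_of_nonneg_left hCe (by positivity : 0 ≤ γ k ^ 2)
          have f8 := mul_le_mul_of_nonneg_left f1 hC
          nlinarith [mul_nonneg hC (sq_nonneg (γ k))]

end IsScheme

end Scheme

/-! ### Real sequences and learning rates -/

section RealSequences

/-- Telescoping of `1/√(k+1) ≤ 2(√(k+1) - √k)`. -/
theorem sum_range_inv_sqrt_le (n : ℕ) :
    ∑ k ∈ Finset.range n, (√((k : ℝ) + 1))⁻¹ ≤ 2 * √(n : ℝ) := by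
  induction n with
  | zero => simp
  | succ n ih =>
    rw [Finset.sum_range_succ]
    have hn : (0 : ℝ) ≤ n := n.cast_nonneg
    have h1 : 0 < √((n : ℝ) + 1) := Real.sqrt_pos.2 (by positivity)
    have h2 : √((n : ℝ) + 1) ^ 2 = n + 1 := Real.sq_sqrt (by positivity)
    have h3 : √(n : ℝ) ^ 2 = n := Real.sq_sqrt hn
    have h4 : (√((n : ℝ) + 1))⁻¹ ≤ 2 * √((n : ℝ) + 1) - 2 * √(n : ℝ) := by
      rw [inv_eq_one_div, div_le_iff₀ h1]
      nlinarith [sq_nonneg (√((n : ℝ) + 1) - √(n : ℝ))]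
    push_cast
    linarith

/-- A null sequence, summed with the weights `1 / √(k + 1)`, is `o(√n)`. -/
theorem tendsto_inv_sqrt_mul_sum {w : ℕ → ℝ} (hw : Tendsto w atTop (𝓝 0)) :
    Tendsto (fun n : ℕ => (√(n : ℝ))⁻¹ * ∑ k ∈ Finset.range n, w k * (√((k : ℝ) + 1))⁻¹)
      atTop (𝓝 0) := by
  have hpos : ∀ k : ℕ, 0 < (√((k : ℝ) + 1))⁻¹ := fun k => by positivity
  have h1 : (fun k : ℕ => w k * (√((k : ℝ) + 1))⁻¹) =o[atTop]
      fun k : ℕ => (√((k : ℝ) + 1))⁻¹ := by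
    have := ((Asymptotics.isLittleO_one_iff ℝ).2 hw).mul_isBigO
      (Asymptotics.isBigO_refl (fun k : ℕ => (√((k : ℝ) + 1))⁻¹) atTop)
    simpa using this
  -- Divergence of the comparison sum, without which a termwise `o` could not be summed.
  have hge : ∀ n : ℕ, √(n : ℝ) ≤ ∑ k ∈ Finset.range n, (√((k : ℝ) + 1))⁻¹ := by
    intro n
    have h : ∀ k ∈ Finset.range n, (√(n : ℝ))⁻¹ ≤ (√((k : ℝ) + 1))⁻¹ := by
      intro k hk
      have : ((k : ℝ) + 1) ≤ n := by exact_mod_cast Finset.mem_range.1 hk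
      gcongr
    have := Finset.sum_le_sum h
    rw [Finset.sum_const, Finset.card_range, nsmul_eq_mul] at this
    refine le_trans (le_of_eq ?_) this
    rcases Nat.eq_zero_or_pos n with rfl | hn
    · simp
    · have : 0 < √(n : ℝ) := Real.sqrt_pos.2 (by exact_mod_cast hn)
      field_simp
      exact Real.sq_sqrt n.cast_nonneg
  have hsq : Tendsto (fun n : ℕ => √(n : ℝ)) atTop atTop :=
    Real.tendsto_sqrt_atTop.comp tendsto_natCast_atTop_atTop
  have h2 := h1.sum_range (fun k => (hpos k).le) (tendsto_atTop_mono hge hsq)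
  have h3 : (fun n : ℕ => ∑ k ∈ Finset.range n, (√((k : ℝ) + 1))⁻¹) =O[atTop]
      fun n : ℕ => √(n : ℝ) := by
    refine Asymptotics.IsBigO.of_bound 2 (Eventually.of_forall fun n => ?_)
    rw [Real.norm_of_nonneg (Finset.sum_nonneg fun k _ => (hpos k).le),
      Real.norm_of_nonneg (Real.sqrt_nonneg _)]
    exact sum_range_inv_sqrt_le n
  have h4 := (h2.trans_isBigO h3).tendsto_div_nhds_zero
  refine h4.congr fun n => ?_
  rw [div_eq_inv_mul]

/-- The sum of a null sequence, divided by `n`, under a square root. -/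
theorem tendsto_inv_sqrt_mul_sqrt_sum {b : ℕ → ℝ} (hb : Tendsto b atTop (𝓝 0)) :
    Tendsto (fun n : ℕ => (√(n : ℝ))⁻¹ * √(∑ k ∈ Finset.range n, b k)) atTop (𝓝 0) := by
  have h1 := hb.cesaro
  have h2 := (Real.continuous_sqrt.tendsto 0).comp h1
  rw [Real.sqrt_zero] at h2
  refine h2.congr fun n => ?_
  simp [Real.sqrt_mul (inv_nonneg.2 (Nat.cast_nonneg (α := ℝ) n)), Real.sqrt_inv]

/-- The requirements on the learning rates of averaged stochastic approximation. -/
structure IsLearningRate (γ : ℕ → ℝ) : Prop where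
  pos : ∀ k, 0 < γ k
  tendsto_zero : Tendsto γ atTop (𝓝 0)
  tendsto_mul : Tendsto (fun n : ℕ => (n : ℝ) * γ n) atTop atTop
  inv_mono : ∀ k, (γ k)⁻¹ ≤ (γ (k + 1))⁻¹
  -- The factor `√(k+1)` is what makes `∑ (γ_{k+1}⁻¹ - γ_k⁻¹) √γ_{k+1}` of order `o(√n)`.
  tendsto_inv_sub : Tendsto (fun k : ℕ => ((γ (k + 1))⁻¹ - (γ k)⁻¹) * √(γ (k + 1)) *
    √((k : ℝ) + 1)) atTop (𝓝 0)

/-- The bound for the first moment of the sum of the errors is `o(√n)`. -/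
theorem IsLearningRate.tendsto_bound {γ : ℕ → ℝ} (h : IsLearningRate γ) {C D : ℝ} (hC : 0 ≤ C)
    (hD : 0 ≤ D) {b : ℕ → ℝ} (hb : Tendsto b atTop (𝓝 0)) :
    Tendsto (fun n : ℕ => (√(n : ℝ))⁻¹ * (√(C * γ n) + √(C * γ 0) + (γ 0)⁻¹ * √(C * γ 0)
      + (γ n)⁻¹ * √(C * γ n)
      + ∑ k ∈ Finset.range n, ((γ (k + 1))⁻¹ - (γ k)⁻¹) * √(C * γ (k + 1))
      + ∑ k ∈ Finset.range n, √(D / ((k : ℝ) + 1)) * √(C * γ k)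
      + √(∑ k ∈ Finset.range n, b k))) atTop (𝓝 0) := by
  have hsq : Tendsto (fun n : ℕ => (√(n : ℝ))⁻¹) atTop (𝓝 0) :=
    tendsto_inv_atTop_zero.comp (Real.tendsto_sqrt_atTop.comp tendsto_natCast_atTop_atTop)
  have hs : Tendsto (fun n : ℕ => √(C * γ n)) atTop (𝓝 0) := by
    have := (Real.continuous_sqrt.tendsto _).comp (h.tendsto_zero.const_mul C)
    simpa [Function.comp_def] using this
  have t1 : Tendsto (fun n : ℕ => (√(n : ℝ))⁻¹ * √(C * γ n)) atTop (𝓝 0) := by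
    simpa using hsq.mul hs
  have t2 : Tendsto (fun n : ℕ => (√(n : ℝ))⁻¹ * √(C * γ 0)) atTop (𝓝 0) := by
    simpa using hsq.mul_const (√(C * γ 0))
  have t3 : Tendsto (fun n : ℕ => (√(n : ℝ))⁻¹ * ((γ 0)⁻¹ * √(C * γ 0))) atTop (𝓝 0) := by
    simpa using hsq.mul_const ((γ 0)⁻¹ * √(C * γ 0))
  -- Up to the factor `√C` this is `(n γ_n)^{-1/2}`.
  have t4 : Tendsto (fun n : ℕ => (√(n : ℝ))⁻¹ * ((γ n)⁻¹ * √(C * γ n))) atTop (𝓝 0) := by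
    have := (tendsto_inv_atTop_zero.comp
      (Real.tendsto_sqrt_atTop.comp h.tendsto_mul)).const_mul (√C)
    rw [mul_zero] at this
    refine this.congr fun n => ?_
    have hg := h.pos n
    simp only [Function.comp_apply]
    rw [Real.sqrt_mul n.cast_nonneg, Real.sqrt_mul hC, mul_inv]
    have : √(γ n) * √(γ n) = γ n := Real.mul_self_sqrt hg.le
    have h0 : √(γ n) ≠ 0 := (Real.sqrt_pos.2 hg).ne'
    nth_rewrite 2 [← this]
    field_simp
  have t5 : Tendsto (fun n : ℕ => (√(n : ℝ))⁻¹ * ∑ k ∈ Finset.range n,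
      ((γ (k + 1))⁻¹ - (γ k)⁻¹) * √(C * γ (k + 1))) atTop (𝓝 0) := by
    -- `Tendsto` is an inequality of filters, so `.trans` replaces the limit `√C * 0` by `0`.
    have := tendsto_inv_sqrt_mul_sum (h.tendsto_inv_sub.const_mul (√C) |>.trans (by simp))
    refine this.congr fun n => ?_
    congr 1
    refine Finset.sum_congr rfl fun k _ => ?_
    have : √((k : ℝ) + 1) ≠ 0 := (Real.sqrt_pos.2 (by positivity)).ne'
    rw [Real.sqrt_mul hC]
    field_simp
  have t6 : Tendsto (fun n : ℕ => (√(n : ℝ))⁻¹ * ∑ k ∈ Finset.range n,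
      √(D / ((k : ℝ) + 1)) * √(C * γ k)) atTop (𝓝 0) := by
    have := tendsto_inv_sqrt_mul_sum (hs.const_mul (√D) |>.trans (by simp))
    refine this.congr fun n => ?_
    congr 1
    refine Finset.sum_congr rfl fun k _ => ?_
    rw [Real.sqrt_div hD]
    ring
  have t7 := tendsto_inv_sqrt_mul_sqrt_sum hb
  have := (((((t1.add t2).add t3).add t4).add t5).add t6).add t7
  simp only [add_zero] at this
  refine this.congr fun n => ?_
  ring

/-- The learning rates `γ₀ (c + k)⁻ᵃ`. -/
theorem isLearningRate_rpow {γ₀ a : ℝ} (hγ₀ : 0 < γ₀) (ha : 0 < a) (ha' : a < 1) {c : ℝ}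
    (hc : 1 ≤ c) : IsLearningRate fun k : ℕ => γ₀ * (c + k) ^ (-a) := by
  have hck : ∀ k : ℕ, 0 < c + k := fun k => by positivity
  have hinv : ∀ k : ℕ, (γ₀ * (c + k) ^ (-a))⁻¹ = γ₀⁻¹ * (c + k) ^ a := fun k => by
    rw [mul_inv, Real.rpow_neg (hck k).le, inv_inv]
  have htop : Tendsto (fun k : ℕ => c + (k : ℝ)) atTop atTop :=
    tendsto_atTop_add_const_left _ _ tendsto_natCast_atTop_atTop
  -- Bernoulli's inequality `(1 + x)^a ≤ 1 + a x` for exponents in `(0, 1)`.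
  have hdiff : ∀ k : ℕ, γ₀⁻¹ * (c + (k + 1 : ℕ)) ^ a - γ₀⁻¹ * (c + k) ^ a ≤
      γ₀⁻¹ * a * (c + k) ^ (a - 1) := fun k => by
    have h1 : (c + (k + 1 : ℕ)) = (c + k) * (1 + (c + k)⁻¹) := by
      have := (hck k).ne'
      push_cast
      field_simp
      ring
    have h2 : (1 + (c + k)⁻¹) ^ a ≤ 1 + a * (c + k)⁻¹ :=
      rpow_one_add_le_one_add_mul_self
        (by have := inv_pos.2 (hck k); linarith) ha.le ha'.le
    rw [h1, Real.mul_rpow (hck k).le (by have := inv_pos.2 (hck k); linarith),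
      Real.rpow_sub_one (hck k).ne']
    have h3 := mul_le_mul_of_nonneg_left h2
      (by have := Real.rpow_pos_of_pos (hck k) a; positivity : 0 ≤ γ₀⁻¹ * (c + k) ^ a)
    calc _ = γ₀⁻¹ * (c + k) ^ a * (1 + (c + k)⁻¹) ^ a - γ₀⁻¹ * (c + k) ^ a := by ring
      _ ≤ γ₀⁻¹ * (c + k) ^ a * (1 + a * (c + k)⁻¹) - γ₀⁻¹ * (c + k) ^ a := by linarith
      _ = _ := by rw [div_eq_mul_inv]; ring
  refine ⟨fun k => mul_pos hγ₀ (Real.rpow_pos_of_pos (hck k) _), ?_, ?_, ?_, ?_⟩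
  · have := ((tendsto_rpow_neg_atTop ha).comp htop).const_mul γ₀
    simpa using this
  · have h1 : Tendsto (fun k : ℕ => γ₀ * (1 + c)⁻¹ * (c + k) ^ (1 - a)) atTop atTop :=
      ((tendsto_rpow_atTop (by linarith)).comp htop).const_mul_atTop (by positivity)
    refine tendsto_atTop_mono' _ ?_ h1
    filter_upwards [eventually_ge_atTop 1] with k hk
    have hk' : (1 : ℝ) ≤ k := by exact_mod_cast hk
    have h2 : (1 + c)⁻¹ * (c + k) ≤ k := by
      rw [inv_mul_le_iff₀ (by linarith)]
      nlinarith
    have h3 := mul_le_mul_of_nonneg_right h2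
      (by have := Real.rpow_pos_of_pos (hck k) (-a); positivity : 0 ≤ γ₀ * (c + k) ^ (-a))
    refine le_trans (le_of_eq ?_) h3
    rw [sub_eq_add_neg, Real.rpow_add (hck k), Real.rpow_one]
    ring
  · intro k
    rw [hinv, hinv]
    have : c + (k : ℝ) ≤ c + (k + 1 : ℕ) := by push_cast; linarith
    have := Real.rpow_le_rpow (hck k).le this ha.le
    gcongr
  · have h1 : Tendsto (fun k : ℕ => γ₀⁻¹ * a * √γ₀ * (c + k) ^ (-((1 - a) / 2))) atTop (𝓝 0) := by
      have := ((tendsto_rpow_neg_atTop (by linarith : 0 < (1 - a) / 2)).comp htop).const_mul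
        (γ₀⁻¹ * a * √γ₀)
      simpa using this
    refine squeeze_zero (fun k => ?_) (fun k => ?_) h1
    · rw [hinv, hinv]
      have : c + (k : ℝ) ≤ c + (k + 1 : ℕ) := by push_cast; linarith
      have := Real.rpow_le_rpow (hck k).le this ha.le
      have : γ₀⁻¹ * (c + (k : ℝ)) ^ a ≤ γ₀⁻¹ * (c + (k + 1 : ℕ)) ^ a := by gcongr
      exact mul_nonneg (mul_nonneg (sub_nonneg.2 this) (Real.sqrt_nonneg _)) (Real.sqrt_nonneg _)
    · rw [hinv, hinv]
      have e1 : √(γ₀ * (c + (k + 1 : ℕ)) ^ (-a)) ≤ √γ₀ * (c + k) ^ (-a / 2) := by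
        rw [Real.sqrt_mul hγ₀.le, Real.sqrt_eq_rpow ((c + (k + 1 : ℕ)) ^ (-a)),
          ← Real.rpow_mul (hck _).le, show -a * (1 / 2) = -a / 2 by ring]
        have : (c + ((k + 1 : ℕ) : ℝ)) ^ (-a / 2) ≤ (c + k) ^ (-a / 2) :=
          Real.rpow_le_rpow_of_nonpos (hck k) (by push_cast; linarith) (by linarith)
        gcongr
      have e2 : √((k : ℝ) + 1) ≤ (c + k) ^ ((1 : ℝ) / 2) := by
        rw [← Real.sqrt_eq_rpow]
        exact Real.sqrt_le_sqrt (by linarith)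
      have p1 := Real.rpow_pos_of_pos (hck k) (a - 1)
      have p2 := Real.rpow_pos_of_pos (hck k) (-a / 2)
      calc _ ≤ γ₀⁻¹ * a * (c + k) ^ (a - 1) * (√γ₀ * (c + k) ^ (-a / 2)) *
            (c + k) ^ ((1 : ℝ) / 2) := by
            gcongr
            exact hdiff k
        _ = γ₀⁻¹ * a * √γ₀ * ((c + k) ^ (a - 1) * (c + k) ^ (-a / 2) *
            (c + k) ^ ((1 : ℝ) / 2)) := by ring
        _ = _ := by
            rw [← Real.rpow_add (hck k), ← Real.rpow_add (hck k)]
            ring_nf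

end RealSequences

/-! ### Asymptotic linearity of the averaged errors -/

namespace IsScheme

variable {Ω 𝓨 E F : Type*} [MeasurableSpace Ω] [MeasurableSpace 𝓨]
  [NormedAddCommGroup E] [InnerProductSpace ℝ E] [FiniteDimensional ℝ E]
  [MeasurableSpace E] [BorelSpace E]
  [NormedAddCommGroup F] [InnerProductSpace ℝ F] [FiniteDimensional ℝ F]
  [MeasurableSpace F] [BorelSpace F]
  {P : Measure Ω} {𝓕 : ℕ → MeasurableSpace Ω} {Y : ℕ → Ω → 𝓨} {ν : Measure 𝓨}
  {T : 𝓨 → E →L[ℝ] F} {T₀ : E →L[ℝ] F} {e : 𝓨 → F} {γ : ℕ → ℝ} {B : ℕ → Ω → F →L[ℝ] E}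
  {δ : ℕ → Ω → E}

/-- Summation by parts for the errors. -/
theorem sum_eq (h : IsScheme P 𝓕 Y ν T T₀ e γ B δ) (hγ : ∀ k, γ k ≠ 0) (B₀ : F →L[ℝ] E)
    (n : ℕ) (ω : Ω) :
    ∑ k ∈ Finset.range n, (δ (k + 1) ω + B₀ (e (Y k ω))) =
      δ n ω - δ 0 ω + (γ 0)⁻¹ • δ 0 ω - (γ n)⁻¹ • δ n ω
      + ∑ k ∈ Finset.range n, ((γ (k + 1))⁻¹ - (γ k)⁻¹) • δ (k + 1) ω
      - ∑ k ∈ Finset.range n, (B k ω ∘L T₀ - .id ℝ E) (δ k ω)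
      - ∑ k ∈ Finset.range n, noise T T₀ e (B k ω, B k ω - B₀, δ k ω) (Y k ω) := by
  induction n with
  | zero => simp
  | succ n ih =>
    rw [Finset.sum_range_succ, ih]
    simp only [Finset.sum_range_succ]
    -- Together with `h2`: `δ + B₀e` is `γ⁻¹(δ_n - δ_{n+1}) - (B T₀ - I)δ` minus the noise. The
    -- first term telescopes up to the increments of `γ⁻¹`.
    have h1 : B n ω (T (Y n ω) (δ n ω) + e (Y n ω)) =
        (γ n)⁻¹ • δ n ω - (γ n)⁻¹ • δ (n + 1) ω := by
      rw [h.step n ω, smul_sub, smul_smul, inv_mul_cancel₀ (hγ n), one_smul]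
      abel
    have h2 : noise T T₀ e (B n ω, B n ω - B₀, δ n ω) (Y n ω) =
        (γ n)⁻¹ • δ n ω - (γ n)⁻¹ • δ (n + 1) ω - B n ω (T₀ (δ n ω)) - B₀ (e (Y n ω)) := by
      rw [← h1]
      simp only [noise, _root_.sub_apply, map_sub, map_add]
      abel
    rw [h2]
    simp only [_root_.sub_apply, ContinuousLinearMap.comp_apply,
      ContinuousLinearMap.id_apply, sub_smul]
    abel

/-- The sum of the noise is a martingale. -/
theorem lintegral_sum_noise_le (h : IsScheme P 𝓕 Y ν T T₀ e γ B δ) [IsProbabilityMeasure P]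
    {X : ℕ → Ω → (F →L[ℝ] E) × (F →L[ℝ] E) × E} (hX : ∀ k, Measurable[𝓕 k] (X k))
    {b : ℕ → ℝ} (hb0 : ∀ k, 0 ≤ b k)
    (hb : ∀ k, ∫⁻ ω, ENNReal.ofReal (2 * (‖(X k ω).1‖ ^ 2 * (∫ y, ‖T y - T₀‖ ^ 2 ∂ν) *
      ‖(X k ω).2.2‖ ^ 2 + ‖(X k ω).2.1‖ ^ 2 * ∫ y, ‖e y‖ ^ 2 ∂ν)) ∂P ≤ ENNReal.ofReal (b k))
    (n : ℕ) :
    Measurable[𝓕 n] (fun ω => ∑ k ∈ Finset.range n, noise T T₀ e (X k ω) (Y k ω)) ∧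
    ∫⁻ ω, ‖∑ k ∈ Finset.range n, noise T T₀ e (X k ω) (Y k ω)‖ₑ ^ 2 ∂P ≤
      ENNReal.ofReal (∑ k ∈ Finset.range n, b k) := by
  induction n with
  | zero => simp
  | succ n ih =>
    have hm := h.mono n.le_succ
    simp only [Finset.sum_range_succ]
    refine ⟨?_, ?_⟩
    · exact (ih.1.mono hm le_rfl).add ((measurable_noise h.measurable_T h.measurable_e).comp
        (((hX n).mono hm le_rfl).prodMk (h.measurable_obs n)))
    -- The partial sum belongs to the past, so there is no cross term with the new noise.
    · refine (h.lintegral_add_noise n ih.1 (hX n)).trans ?_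
      rw [ENNReal.ofReal_add (Finset.sum_nonneg fun k _ => hb0 k) (hb0 n)]
      exact add_le_add ih.2 (hb n)

theorem eLpNorm_sum_le_ofReal {ι H : Type*} [NormedAddCommGroup H] {P : Measure Ω} {f : ι → Ω → H}
    {s : Finset ι} {c : ι → ℝ} (hf : ∀ i ∈ s, AEStronglyMeasurable (f i) P) (hc : ∀ i, 0 ≤ c i)
    (h : ∀ i, eLpNorm (f i) 1 P ≤ ENNReal.ofReal (c i)) :
    eLpNorm (fun ω => ∑ i ∈ s, f i ω) 1 P ≤ ENNReal.ofReal (∑ i ∈ s, c i) := by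
  rw [ENNReal.ofReal_sum_of_nonneg fun i _ => hc i]
  have := (eLpNorm_sum_le hf le_rfl).trans (Finset.sum_le_sum fun i _ => h i)
  rwa [show ∑ i ∈ s, f i = fun ω => ∑ i ∈ s, f i ω from
    funext fun ω => Finset.sum_apply ω s f] at this

theorem eLpNorm_add_le_ofReal {H : Type*} [NormedAddCommGroup H] {P : Measure Ω} {f g : Ω → H}
    {c d : ℝ} (hf : AEStronglyMeasurable f P) (hg : AEStronglyMeasurable g P) (hc : 0 ≤ c)
    (hd : 0 ≤ d) (h1 : eLpNorm f 1 P ≤ ENNReal.ofReal c) (h2 : eLpNorm g 1 P ≤ ENNReal.ofReal d) :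
    eLpNorm (fun ω => f ω + g ω) 1 P ≤ ENNReal.ofReal (c + d) := by
  rw [ENNReal.ofReal_add hc hd]
  exact (eLpNorm_add_le hf hg le_rfl).trans (add_le_add h1 h2)

theorem eLpNorm_sub_le_ofReal {H : Type*} [NormedAddCommGroup H] {P : Measure Ω} {f g : Ω → H}
    {c d : ℝ} (hf : AEStronglyMeasurable f P) (hg : AEStronglyMeasurable g P) (hc : 0 ≤ c)
    (hd : 0 ≤ d) (h1 : eLpNorm f 1 P ≤ ENNReal.ofReal c) (h2 : eLpNorm g 1 P ≤ ENNReal.ofReal d) :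
    eLpNorm (fun ω => f ω - g ω) 1 P ≤ ENNReal.ofReal (c + d) := by
  rw [ENNReal.ofReal_add hc hd]
  exact (eLpNorm_sub_le hf hg le_rfl).trans (add_le_add h1 h2)

theorem eLpNorm_smul_le_ofReal {H : Type*} [NormedAddCommGroup H] [NormedSpace ℝ H]
    {P : Measure Ω} {f : Ω → H}
    {c d : ℝ} (hd : 0 ≤ d) (h1 : eLpNorm f 1 P ≤ ENNReal.ofReal c) :
    eLpNorm (fun ω => d • f ω) 1 P ≤ ENNReal.ofReal (d * c) := by
  rw [ENNReal.ofReal_mul hd, ← Real.enorm_of_nonneg hd]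
  refine le_trans (le_of_eq (eLpNorm_const_smul d f 1 P)) ?_
  gcongr

/-- The averaged errors behave like the averaged noise. -/
theorem tendstoInMeasure (h : IsScheme P 𝓕 Y ν T T₀ e γ B δ) [IsProbabilityMeasure P]
    {K M D : ℝ} {B₀ : F →L[ℝ] E} (hγ : IsLearningRate γ) (hB : ∀ k ω, ‖B k ω‖ ≤ K)
    (hB₀ : ‖B₀‖ ≤ K) (hBB : ∀ᵐ ω ∂P, Tendsto (fun k => B k ω) atTop (𝓝 B₀))
    (hBT : ∀ k ω, ‖B k ω ∘L T₀ - .id ℝ E‖ ≤ 1 / 2) (hγ1 : ∀ k, γ k ≤ 1)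
    (hγK : ∀ k, γ k * (1 / 4 + 2 * K ^ 2 * ∫ y, ‖T y - T₀‖ ^ 2 ∂ν) ≤ 1 / 4)
    (hγr : ∀ k, (γ (k + 1))⁻¹ - (γ k)⁻¹ ≤ 1 / 4) (h0 : ∀ ω, ‖δ 0 ω‖ ≤ M)
    (hD : 0 ≤ D)
    (hBT2 : ∀ k : ℕ, ∫⁻ ω, ‖B k ω ∘L T₀ - .id ℝ E‖ₑ ^ 2 ∂P ≤ ENNReal.ofReal (D / ((k : ℝ) + 1))) :
    TendstoInMeasure P (fun (n : ℕ) ω =>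
      (√(n : ℝ))⁻¹ • ∑ k ∈ Finset.range n, (δ (k + 1) ω + B₀ (e (Y k ω)))) atTop (fun _ => 0) := by
  set τ := ∫ y, ‖T y - T₀‖ ^ 2 ∂ν with hτ
  set σ := ∫ y, ‖e y‖ ^ 2 ∂ν with hσ
  have hτ0 : 0 ≤ τ := integral_nonneg fun _ => by positivity
  have hσ0 : 0 ≤ σ := integral_nonneg fun _ => by positivity
  have hg0 := hγ.pos 0
  -- The first summand absorbs the additive noise, the second the initial error.
  set C : ℝ := 4 * (2 * K ^ 2 * σ) + M ^ 2 * (γ 0)⁻¹ with hCdef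
  have hC : 0 ≤ C := by positivity
  have hδm : ∀ k, Measurable (δ k) := fun k => (h.measurable_δ k).mono (h.le k) le_rfl
  have hBm : ∀ k, Measurable (B k) := fun k => (h.measurable_B k).mono (h.le k) le_rfl
  have hδ2 : ∀ k, ∫⁻ ω, ‖δ k ω‖ₑ ^ 2 ∂P ≤ ENNReal.ofReal (C * γ k) := by
    refine h.lintegral_enorm_sq_le hB hBT hγ.pos hγ1 hC hγK hγr ?_ ?_
    · have : 0 ≤ M ^ 2 * (γ 0)⁻¹ := by positivity
      linarith
    · intro ω
      have h1 : ‖δ 0 ω‖ ^ 2 ≤ M ^ 2 := by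
        have := h0 ω
        gcongr
      have h2 : C * γ 0 = 4 * (2 * K ^ 2 * σ) * γ 0 + M ^ 2 := by
        rw [hCdef]; field_simp
      have : 0 ≤ 4 * (2 * K ^ 2 * σ) * γ 0 := by positivity
      linarith
  have hδ1 : ∀ k, eLpNorm (δ k) 1 P ≤ ENNReal.ofReal (√(C * γ k)) := fun k => by
    rw [eLpNorm_one_eq_lintegral_enorm]
    exact lintegral_enorm_le_ofReal_sqrt (hδm k).aemeasurable (hδ2 k)
  set v : ℕ → ℝ := fun k => ∫ ω, ‖B k ω - B₀‖ ^ 2 ∂P with hv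
  have hvb : ∀ k ω, ‖B k ω - B₀‖ ^ 2 ≤ (2 * K) ^ 2 := fun k ω => by
    have : ‖B k ω - B₀‖ ≤ 2 * K := (norm_sub_le _ _).trans (by linarith [hB k ω])
    gcongr
  have hvm : ∀ k, Measurable fun ω => ‖B k ω - B₀‖ ^ 2 := fun k =>
    ((hBm k).sub_const B₀).norm.pow_const 2
  have hvi : ∀ k, Integrable (fun ω => ‖B k ω - B₀‖ ^ 2) P := fun k =>
    Integrable.of_bound (hvm k).aestronglyMeasurable ((2 * K) ^ 2)
      (Eventually.of_forall fun ω => by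
        rw [Real.norm_of_nonneg (by positivity)]; exact hvb k ω)
  -- Almost sure convergence suffices here, by domination with `(2K)²`; no rate for `B k` is used.
  have hv0 : Tendsto v atTop (𝓝 0) := by
    have : Tendsto v atTop (𝓝 (∫ _, (0 : ℝ) ∂P)) := by
      refine tendsto_integral_of_dominated_convergence (fun _ => (2 * K) ^ 2)
        (fun k => (hvm k).aestronglyMeasurable) (integrable_const _)
        (fun k => Eventually.of_forall fun ω => by
          rw [Real.norm_of_nonneg (by positivity)]; exact hvb k ω) ?_
      filter_upwards [hBB] with ω hω
      have := ((hω.sub_const B₀).norm).pow 2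
      simpa using this
    simpa using this
  have hvnn : ∀ k, 0 ≤ v k := fun k => integral_nonneg fun _ => by positivity
  set b : ℕ → ℝ := fun k => 2 * (K ^ 2 * τ * (C * γ k) + v k * σ) with hb
  have hb0 : ∀ k, 0 ≤ b k := fun k => by
    have := (hγ.pos k).le
    have := hvnn k
    positivity
  have hbt : Tendsto b atTop (𝓝 0) := by
    have := (((hγ.tendsto_zero.const_mul C).const_mul (K ^ 2 * τ)).add
      (hv0.mul_const σ)).const_mul 2
    simpa using this
  have hX : ∀ k, Measurable[𝓕 k] fun ω => (B k ω, B k ω - B₀, δ k ω) := fun k =>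
    (h.measurable_B k).prodMk (((h.measurable_B k).sub_const B₀).prodMk (h.measurable_δ k))
  have hbound : ∀ k, ∫⁻ ω, ENNReal.ofReal (2 * (‖B k ω‖ ^ 2 * τ * ‖δ k ω‖ ^ 2 +
      ‖B k ω - B₀‖ ^ 2 * σ)) ∂P ≤ ENNReal.ofReal (b k) := by
    intro k
    calc _ ≤ ∫⁻ ω, (ENNReal.ofReal (2 * (K ^ 2 * τ)) * ‖δ k ω‖ₑ ^ 2 +
          ENNReal.ofReal (2 * σ) * ENNReal.ofReal (‖B k ω - B₀‖ ^ 2)) ∂P := by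
          refine lintegral_mono fun ω => ?_
          rw [enorm_sq_eq_ofReal, ← ENNReal.ofReal_mul (by positivity),
            ← ENNReal.ofReal_mul (by positivity), ← ENNReal.ofReal_add (by positivity)
              (by positivity)]
          refine ENNReal.ofReal_le_ofReal ?_
          have h1 : ‖B k ω‖ ^ 2 ≤ K ^ 2 := by
            have := hB k ω
            gcongr
          calc _ ≤ 2 * (K ^ 2 * τ * ‖δ k ω‖ ^ 2 + ‖B k ω - B₀‖ ^ 2 * σ) := by gcongr
            _ = _ := by ring
      _ = ENNReal.ofReal (2 * (K ^ 2 * τ)) * ∫⁻ ω, ‖δ k ω‖ₑ ^ 2 ∂P +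
          ENNReal.ofReal (2 * σ) * ENNReal.ofReal (v k) := by
          rw [lintegral_add_left (((hδm k).enorm.pow_const 2).const_mul _),
            lintegral_const_mul _ ((hδm k).enorm.pow_const 2),
            lintegral_const_mul _ (hvm k).ennreal_ofReal,
            ofReal_integral_eq_lintegral_ofReal (hvi k)
              (Eventually.of_forall fun _ => by positivity)]
      _ ≤ ENNReal.ofReal (2 * (K ^ 2 * τ)) * ENNReal.ofReal (C * γ k) +
          ENNReal.ofReal (2 * σ) * ENNReal.ofReal (v k) := by
          gcongr
          exact hδ2 k
      _ = ENNReal.ofReal (b k) := by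
          have := hγ.pos k
          have := hvnn k
          rw [← ENNReal.ofReal_mul (by positivity), ← ENNReal.ofReal_mul (by positivity),
            ← ENNReal.ofReal_add (by positivity) (by positivity)]
          congr 1
          simp only [hb]
          ring
  have hmart := h.lintegral_sum_noise_le hX hb0 hbound
  have hm1 : ∀ k, Measurable fun ω => (B k ω ∘L T₀ - .id ℝ E) (δ k ω) := fun k => by
    simp only [_root_.sub_apply, ContinuousLinearMap.comp_apply, ContinuousLinearMap.id_apply]
    exact (ContinuousLinearMap.measurable_apply₂.comp
      ((hBm k).prodMk (T₀.continuous.measurable.comp (hδm k)))).sub (hδm k)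
  have hm2 : ∀ n, Measurable fun ω => ∑ k ∈ Finset.range n,
      noise T T₀ e (B k ω, B k ω - B₀, δ k ω) (Y k ω) := fun n =>
    (hmart n).1.mono (h.le n) le_rfl
  have hB1m : ∀ k, Measurable fun ω => ‖B k ω ∘L T₀ - .id ℝ E‖ₑ := fun k => by
    have : Continuous fun L : F →L[ℝ] E => ‖L ∘L T₀ - .id ℝ E‖ₑ := by fun_prop
    exact this.measurable.comp (hBm k)
  -- Cauchy–Schwarz: the operator is of order `k^{-1/2}` and the error of order `√γ_k`, so the sum
  -- over `k < n` is `o(√n)`.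
  have hcross : ∀ k : ℕ, eLpNorm (fun ω => (B k ω ∘L T₀ - .id ℝ E) (δ k ω)) 1 P ≤
      ENNReal.ofReal (√(D / ((k : ℝ) + 1)) * √(C * γ k)) := fun k => by
    rw [eLpNorm_one_eq_lintegral_enorm]
    refine le_trans (lintegral_mono fun ω => ContinuousLinearMap.le_opENorm _ _) ?_
    exact lintegral_mul_le_ofReal_sqrt (hB1m k).aemeasurable (hδm k).enorm.aemeasurable
      (by positivity) (mul_nonneg hC (hγ.pos k).le) (hBT2 k) (hδ2 k)
  have hnoise : ∀ n, eLpNorm (fun ω => ∑ k ∈ Finset.range n,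
      noise T T₀ e (B k ω, B k ω - B₀, δ k ω) (Y k ω)) 1 P ≤
      ENNReal.ofReal (√(∑ k ∈ Finset.range n, b k)) := fun n => by
    rw [eLpNorm_one_eq_lintegral_enorm]
    exact lintegral_enorm_le_ofReal_sqrt (hm2 n).aemeasurable (hmart n).2
  have hinvnn : ∀ k, 0 ≤ (γ (k + 1))⁻¹ - (γ k)⁻¹ := fun k => sub_nonneg.2 (hγ.inv_mono k)
  have hpinv : ∀ k, 0 ≤ (γ k)⁻¹ := fun k => (inv_pos.2 (hγ.pos k)).le
  have hδs : ∀ k, AEStronglyMeasurable (δ k) P := fun k => (hδm k).aestronglyMeasurable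
  have hsum : ∀ n, eLpNorm (fun ω => ∑ k ∈ Finset.range n, (δ (k + 1) ω + B₀ (e (Y k ω)))) 1 P ≤
      ENNReal.ofReal (√(C * γ n) + √(C * γ 0) + (γ 0)⁻¹ * √(C * γ 0)
      + (γ n)⁻¹ * √(C * γ n)
      + ∑ k ∈ Finset.range n, ((γ (k + 1))⁻¹ - (γ k)⁻¹) * √(C * γ (k + 1))
      + ∑ k ∈ Finset.range n, √(D / ((k : ℝ) + 1)) * √(C * γ k)
      + √(∑ k ∈ Finset.range n, b k)) := fun n => by
    rw [show (fun ω => ∑ k ∈ Finset.range n, (δ (k + 1) ω + B₀ (e (Y k ω)))) = _ from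
      funext (h.sum_eq (fun k => (hγ.pos k).ne') B₀ n)]
    have q0 := Real.sqrt_nonneg (C * γ 0)
    have qn := Real.sqrt_nonneg (C * γ n)
    have r1 : 0 ≤ √(C * γ n) + √(C * γ 0) := by positivity
    have r2 : 0 ≤ (γ 0)⁻¹ * √(C * γ 0) := mul_nonneg (hpinv 0) q0
    have r3 : 0 ≤ (γ n)⁻¹ * √(C * γ n) := mul_nonneg (hpinv n) qn
    have r4 : ∀ k, 0 ≤ ((γ (k + 1))⁻¹ - (γ k)⁻¹) * √(C * γ (k + 1)) := fun k =>
      mul_nonneg (hinvnn k) (Real.sqrt_nonneg _)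
    have r5 : ∀ k : ℕ, 0 ≤ √(D / ((k : ℝ) + 1)) * √(C * γ k) := fun k => by positivity
    have s4 := Finset.sum_nonneg fun k (_ : k ∈ Finset.range n) => r4 k
    have s5 := Finset.sum_nonneg fun k (_ : k ∈ Finset.range n) => r5 k
    have a1 : AEStronglyMeasurable (fun ω => δ n ω - δ 0 ω) P := (hδs n).sub (hδs 0)
    have a2 : AEStronglyMeasurable (fun ω => δ n ω - δ 0 ω + (γ 0)⁻¹ • δ 0 ω) P :=
      a1.add ((hδs 0).const_smul _)
    have a3 : AEStronglyMeasurable (fun ω => δ n ω - δ 0 ω + (γ 0)⁻¹ • δ 0 ω -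
      (γ n)⁻¹ • δ n ω) P := a2.sub ((hδs n).const_smul _)
    have a4' : AEStronglyMeasurable (fun ω => ∑ k ∈ Finset.range n,
        ((γ (k + 1))⁻¹ - (γ k)⁻¹) • δ (k + 1) ω) P :=
      Finset.aestronglyMeasurable_fun_sum _ fun k _ => (hδs (k + 1)).const_smul _
    have a5' : AEStronglyMeasurable (fun ω => ∑ k ∈ Finset.range n,
        (B k ω ∘L T₀ - .id ℝ E) (δ k ω)) P :=
      Finset.aestronglyMeasurable_fun_sum _ fun k _ => (hm1 k).aestronglyMeasurable
    refine eLpNorm_sub_le_ofReal ((a3.add a4').sub a5') (hm2 n).aestronglyMeasurable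
      (by positivity) (Real.sqrt_nonneg _) ?_ (hnoise n)
    refine eLpNorm_sub_le_ofReal (a3.add a4') a5' (by positivity) s5 ?_
      (eLpNorm_sum_le_ofReal (fun k _ => (hm1 k).aestronglyMeasurable) r5 hcross)
    refine eLpNorm_add_le_ofReal a3 a4' (by positivity) s4 ?_
      (eLpNorm_sum_le_ofReal (fun k _ => (hδs (k + 1)).const_smul _) r4
        fun k => eLpNorm_smul_le_ofReal (hinvnn k) (hδ1 (k + 1)))
    refine eLpNorm_sub_le_ofReal a2 ((hδs n).const_smul _) (by positivity) r3 ?_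
      (eLpNorm_smul_le_ofReal (hpinv n) (hδ1 n))
    refine eLpNorm_add_le_ofReal a1 ((hδs 0).const_smul _) r1 r2 ?_
      (eLpNorm_smul_le_ofReal (hpinv 0) (hδ1 0))
    exact eLpNorm_sub_le_ofReal (hδs n) (hδs 0) qn q0 (hδ1 n) (hδ1 0)
  have hYm : ∀ k, Measurable (Y k) := fun k => (h.measurable_obs k).mono (h.le _) le_rfl
  refine tendstoInMeasure_of_tendsto_eLpNorm one_ne_zero (fun n => ?_)
    aestronglyMeasurable_const ?_
  · refine (Finset.measurable_fun_sum _ fun k _ => ?_).const_smul _ |>.aestronglyMeasurable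
    exact (hδm (k + 1)).add (B₀.continuous.measurable.comp (h.measurable_e.comp (hYm k)))
  · have hlim := ENNReal.tendsto_ofReal (hγ.tendsto_bound hC hD hbt)
    rw [ENNReal.ofReal_zero] at hlim
    refine tendsto_of_tendsto_of_tendsto_of_le_of_le tendsto_const_nhds hlim
      (fun _ => zero_le) fun n => ?_
    have := eLpNorm_smul_le_ofReal (inv_nonneg.2 (Real.sqrt_nonneg (n : ℝ))) (hsum n)
    rwa [← sub_zero (fun ω => (√(n : ℝ))⁻¹ • _)] at this

end IsScheme

/-! ### Borel structure on matrices and measurability of the Moore–Penrose inverse -/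

section MatrixMeasurability

instance instMeasurableSpaceMatrix {m n : ℕ} : MeasurableSpace (Matrix (Fin m) (Fin n) ℝ) :=
  MeasurableSpace.pi

instance instBorelSpaceMatrix {m n : ℕ} : BorelSpace (Matrix (Fin m) (Fin n) ℝ) :=
  inferInstanceAs (BorelSpace (Fin m → Fin n → ℝ))

instance instSecondCountableTopologyMatrix {m n : ℕ} :
    SecondCountableTopology (Matrix (Fin m) (Fin n) ℝ) :=
  inferInstanceAs (SecondCountableTopology (Fin m → Fin n → ℝ))

instance instPolishSpaceMatrix {m n : ℕ} : PolishSpace (Matrix (Fin m) (Fin n) ℝ) :=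
  inferInstanceAs (PolishSpace (Fin m → Fin n → ℝ))

variable {Ω : Type*} [MeasurableSpace Ω] {l m n : ℕ}

theorem measurable_matrix_iff {A : Ω → Matrix (Fin m) (Fin n) ℝ} :
    Measurable A ↔ ∀ i j, Measurable fun ω => A ω i j := by
  refine measurable_pi_iff.trans (forall_congr' fun i => ?_)
  exact measurable_pi_iff

theorem measurable_matrix_mul {A : Ω → Matrix (Fin l) (Fin m) ℝ}
    {B : Ω → Matrix (Fin m) (Fin n) ℝ} (hA : Measurable A) (hB : Measurable B) :
    Measurable fun ω => A ω * B ω := by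
  have : Continuous fun p : Matrix (Fin l) (Fin m) ℝ × Matrix (Fin m) (Fin n) ℝ => p.1 * p.2 :=
    continuous_fst.matrix_mul continuous_snd
  exact this.measurable.comp (hA.prodMk hB)

theorem measurable_matrix_transpose {A : Ω → Matrix (Fin l) (Fin m) ℝ} (hA : Measurable A) :
    Measurable fun ω => (A ω)ᵀ :=
  (continuous_id.matrix_transpose.measurable).comp hA

theorem measurable_matrix_inv {A : Ω → Matrix (Fin m) (Fin m) ℝ} (hA : Measurable A) :
    Measurable fun ω => (A ω)⁻¹ := by
  simp only [Matrix.inv_def, Ring.inverse_eq_inv']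
  exact ((continuous_id.matrix_det.measurable.comp hA).inv).smul
    (continuous_id.matrix_adjugate.measurable.comp hA)

/-- The Moore–Penrose inverse is a Borel function: its graph is closed. -/
theorem measurable_pinv :
    Measurable (pinv : Matrix (Fin m) (Fin n) ℝ → Matrix (Fin n) (Fin m) ℝ) := by
  intro s hs
  set R : Set (Matrix (Fin m) (Fin n) ℝ × Matrix (Fin n) (Fin m) ℝ) :=
    {p | IsMoorePenrose p.1 p.2} with hR
  have hRc : IsClosed R := by
    have : R = {p | p.1 * p.2 * p.1 = p.1} ∩ {p | p.2 * p.1 * p.2 = p.2} ∩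
        {p | (p.1 * p.2)ᵀ = p.1 * p.2} ∩ {p | (p.2 * p.1)ᵀ = p.2 * p.1} := by
      ext p
      exact ⟨fun h => ⟨⟨⟨h.1, h.2⟩, h.3⟩, h.4⟩, fun h => ⟨h.1.1.1, h.1.1.2, h.1.2, h.2⟩⟩
    rw [this]
    have h1 : Continuous fun p : Matrix (Fin m) (Fin n) ℝ × Matrix (Fin n) (Fin m) ℝ =>
      p.1 * p.2 := continuous_fst.matrix_mul continuous_snd
    have h2 : Continuous fun p : Matrix (Fin m) (Fin n) ℝ × Matrix (Fin n) (Fin m) ℝ =>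
      p.2 * p.1 := continuous_snd.matrix_mul continuous_fst
    exact (((isClosed_eq (h1.matrix_mul continuous_fst) continuous_fst).inter
      (isClosed_eq (h2.matrix_mul continuous_snd) continuous_snd)).inter
      (isClosed_eq h1.matrix_transpose h1)).inter (isClosed_eq h2.matrix_transpose h2)
  have himage : pinv ⁻¹' s = Prod.fst '' (R ∩ Prod.snd ⁻¹' s) := by
    ext A
    constructor
    · intro hA
      exact ⟨(A, pinv A), ⟨pinv_spec A, hA⟩, rfl⟩
    · rintro ⟨⟨A', B⟩, ⟨h1, h2⟩, rfl⟩
      have : pinv A' = B := (pinv_spec A').unique h1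
      simpa [this] using h2
  rw [himage]
  -- Lusin–Souslin: the projection of a Borel part of the graph is Borel because uniqueness of the
  -- inverse makes the projection injective there.
  refine (hRc.measurableSet.inter (measurable_snd hs)).image_of_measurable_injOn measurable_fst ?_
  rintro ⟨A, B⟩ ⟨h1, -⟩ ⟨A', B'⟩ ⟨h2, -⟩ h
  simp only at h
  subst h
  exact Prod.ext rfl (IsMoorePenrose.unique h1 h2)

end MatrixMeasurability

/-! ### Matrices as operators, rank-one updates and the preconditioner -/

section LinearAlgebra

variable {l m n : ℕ}

theorem pinv_eq_inv {A : Matrix (Fin n) (Fin n) ℝ} (hA : IsUnit A.det) : pinv A = A⁻¹ := by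
  refine (pinv_spec A).unique ⟨?_, ?_, ?_, ?_⟩
  · rw [Matrix.mul_nonsing_inv _ hA, Matrix.one_mul]
  · rw [Matrix.nonsing_inv_mul _ hA, Matrix.one_mul]
  · rw [Matrix.mul_nonsing_inv _ hA, Matrix.transpose_one]
  · rw [Matrix.nonsing_inv_mul _ hA, Matrix.transpose_one]

/-- A real matrix as a continuous linear map between Euclidean spaces. -/
def toCLM : Matrix (Fin m) (Fin n) ℝ →L[ℝ]
    (EuclideanSpace ℝ (Fin n) →L[ℝ] EuclideanSpace ℝ (Fin m)) :=
  LinearMap.toContinuousLinearMap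
    (Matrix.toEuclideanLin ≪≫ₗ LinearMap.toContinuousLinearMap :
      Matrix (Fin m) (Fin n) ℝ ≃ₗ[ℝ] _).toLinearMap

theorem toCLM_apply (A : Matrix (Fin m) (Fin n) ℝ) (v : EuclideanSpace ℝ (Fin n)) :
    toCLM A v = WithLp.toLp 2 (A *ᵥ v.ofLp) := rfl

/-- The matrix norm in scope is the operator norm for Euclidean norms. -/
theorem norm_toCLM (A : Matrix (Fin m) (Fin n) ℝ) : ‖toCLM A‖ = ‖A‖ := rfl

theorem toCLM_mul (A : Matrix (Fin l) (Fin m) ℝ) (B : Matrix (Fin m) (Fin n) ℝ) :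
    toCLM (A * B) = toCLM A ∘L toCLM B := by
  ext v : 1
  simp [toCLM_apply, Matrix.mulVec_mulVec]

theorem toCLM_one : toCLM (1 : Matrix (Fin n) (Fin n) ℝ) = .id ℝ _ := by
  ext v : 1
  simp [toCLM_apply]

theorem measurable_toCLM : Measurable (toCLM : Matrix (Fin m) (Fin n) ℝ → _) :=
  toCLM.continuous.measurable

theorem norm_mul_le' (A : Matrix (Fin l) (Fin m) ℝ) (B : Matrix (Fin m) (Fin n) ℝ) :
    ‖A * B‖ ≤ ‖A‖ * ‖B‖ := Matrix.l2_opNorm_mul A B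

/-- The operator norm is controlled by the entries. -/
theorem exists_norm_sq_le_sum_sq (m n : ℕ) : ∃ c : ℝ, 0 ≤ c ∧ ∀ A : Matrix (Fin m) (Fin n) ℝ,
    ‖A‖ ^ 2 ≤ c * ∑ i, ∑ j, A i j ^ 2 := by
  refine ⟨∑ p : Fin m × Fin n, ‖(Matrix.single p.1 p.2 1 : Matrix (Fin m) (Fin n) ℝ)‖ ^ 2,
    by positivity, fun A => ?_⟩
  have h1 : ‖A‖ ≤ ∑ p : Fin m × Fin n,
      ‖(Matrix.single p.1 p.2 1 : Matrix (Fin m) (Fin n) ℝ)‖ * |A p.1 p.2| := by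
    conv_lhs => rw [Matrix.matrix_eq_sum_single A]
    rw [Fintype.sum_prod_type]
    refine (norm_sum_le _ _).trans (Finset.sum_le_sum fun i _ => ?_)
    refine (norm_sum_le _ _).trans (Finset.sum_le_sum fun j _ => ?_)
    have : Matrix.single i j (A i j) = A i j • (Matrix.single i j 1 : Matrix _ _ ℝ) := by
      rw [Matrix.smul_single]; simp
    rw [this, norm_smul, mul_comm, Real.norm_eq_abs]
  calc ‖A‖ ^ 2 ≤ (∑ p : Fin m × Fin n,
      ‖(Matrix.single p.1 p.2 1 : Matrix (Fin m) (Fin n) ℝ)‖ * |A p.1 p.2|) ^ 2 := by gcongr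
    _ ≤ _ := Finset.sum_mul_sq_le_sq_mul_sq _ _ _
    _ = _ := by
      congr 1
      rw [Fintype.sum_prod_type]
      simp

/-- The Sherman–Morrison update of the inverse of a running mean. -/
theorem inv_running_mean {Q : Matrix (Fin n) (Fin n) ℝ} (hQ : Q.PosDef) {s : ℝ} (hs : 0 < s)
    (z : Fin n → ℝ) :
    ((s + 1) / s) • (Q⁻¹ * (1 - (s + z ⬝ᵥ (Q⁻¹ *ᵥ z))⁻¹ • (Matrix.vecMulVec z z * Q⁻¹))) =
      ((s / (s + 1)) • Q + (1 / (s + 1)) • Matrix.vecMulVec z z)⁻¹ := by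
  have hdet : IsUnit Q.det := hQ.isUnit.map Matrix.detMonoidHom
  have hQi := hQ.inv
  set w : ℝ := z ⬝ᵥ (Q⁻¹ *ᵥ z) with hw
  have hw0 : 0 ≤ w := by
    have := hQi.posSemidef.dotProduct_mulVec_nonneg z
    simpa using this
  have hm : s + w ≠ 0 := by positivity
  set X : Matrix (Fin n) (Fin n) ℝ := Matrix.vecMulVec z z * Q⁻¹ with hX
  -- `zz'Q⁻¹` has rank one, so its powers are multiples of itself, and inverting `1 + s⁻¹ • X`
  -- reduces to the scalar identity `h2`.
  have hXX : X * X = w • X := by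
    have key : Matrix.vecMulVec z z * (Q⁻¹ * Matrix.vecMulVec z z) = w • Matrix.vecMulVec z z := by
      rw [Matrix.mul_vecMulVec, Matrix.vecMulVec_mul_vecMulVec, Matrix.vecMulVec_smul]
    calc X * X = Matrix.vecMulVec z z * (Q⁻¹ * Matrix.vecMulVec z z) * Q⁻¹ := by
          simp only [hX, Matrix.mul_assoc]
      _ = w • X := by rw [key, smul_mul_assoc]
  symm
  apply Matrix.inv_eq_right_inv
  have hfac : (s / (s + 1)) • Q + (1 / (s + 1)) • Matrix.vecMulVec z z =
      (s / (s + 1)) • ((1 + s⁻¹ • X) * Q) := by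
    rw [Matrix.add_mul, Matrix.one_mul, smul_mul_assoc, hX, Matrix.mul_assoc,
      Matrix.nonsing_inv_mul _ hdet, Matrix.mul_one, smul_add, smul_smul]
    congr 2
    field_simp
  rw [hfac, smul_mul_smul_comm, Matrix.mul_assoc, ← Matrix.mul_assoc Q,
    Matrix.mul_nonsing_inv _ hdet, Matrix.one_mul]
  have h1 : s / (s + 1) * ((s + 1) / s) = 1 := by field_simp
  rw [h1, one_smul, Matrix.add_mul, Matrix.one_mul, Matrix.mul_sub, Matrix.mul_one,
    smul_mul_smul_comm, hXX, smul_smul]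
  have h2 : s⁻¹ - (s + w)⁻¹ - s⁻¹ * (s + w)⁻¹ * w = 0 := by field_simp; ring
  have h3 : (1 : Matrix (Fin n) (Fin n) ℝ) - (s + w)⁻¹ • X +
      (s⁻¹ • X - (s⁻¹ * (s + w)⁻¹ * w) • X) =
      1 + (s⁻¹ - (s + w)⁻¹ - s⁻¹ * (s + w)⁻¹ * w) • X := by
    rw [sub_smul, sub_smul]; abel
  rw [h3, h2, zero_smul, add_zero]

/-- Definiteness of `G'G` makes `G` injective, and congruence by an injective matrix preserves
definiteness. -/
theorem posDef_transpose_mul_mul {G : Matrix (Fin m) (Fin n) ℝ} (hG : (Gᵀ * G).PosDef)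
    {W : Matrix (Fin m) (Fin m) ℝ} (hW : W.PosDef) : (Gᵀ * W * G).PosDef := by
  have hinj : Function.Injective G.mulVec := by
    intro u v huv
    have : Function.Injective (Gᵀ * G).mulVec := Matrix.mulVec_injective_of_isUnit hG.isUnit
    apply this
    rw [← Matrix.mulVec_mulVec, ← Matrix.mulVec_mulVec, huv]
  simpa using hW.conjTranspose_mul_mul_same hinj

theorem tendsto_matrix_inv {ι : Type*} {f : Filter ι} {A : ι → Matrix (Fin n) (Fin n) ℝ}
    {A₀ : Matrix (Fin n) (Fin n) ℝ} (hA : Tendsto A f (𝓝 A₀)) (h : IsUnit A₀.det) :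
    Tendsto (fun i => (A i)⁻¹) f (𝓝 A₀⁻¹) := by
  simp only [Matrix.inv_def, Ring.inverse_eq_inv']
  exact (((continuous_id.matrix_det.tendsto A₀).comp hA).inv₀ h.ne_zero).smul
    ((continuous_id.matrix_adjugate.tendsto A₀).comp hA)

theorem tendsto_matrix_mul {ι : Type*} {f : Filter ι} {A : ι → Matrix (Fin l) (Fin m) ℝ}
    {A₀ : Matrix (Fin l) (Fin m) ℝ} {B : ι → Matrix (Fin m) (Fin n) ℝ}
    {B₀ : Matrix (Fin m) (Fin n) ℝ} (hA : Tendsto A f (𝓝 A₀)) (hB : Tendsto B f (𝓝 B₀)) :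
    Tendsto (fun i => A i * B i) f (𝓝 (A₀ * B₀)) := by
  have : Continuous fun p : Matrix (Fin l) (Fin m) ℝ × Matrix (Fin m) (Fin n) ℝ => p.1 * p.2 :=
    continuous_fst.matrix_mul continuous_snd
  exact (this.tendsto (A₀, B₀)).comp (hA.prodMk_nhds hB)

/-- The preconditioner `(Φ'WΦ)†Φ'W`. -/
def precond (Φ : Matrix (Fin m) (Fin n) ℝ) (W : Matrix (Fin m) (Fin m) ℝ) :
    Matrix (Fin n) (Fin m) ℝ := pinv (Φᵀ * W * Φ) * Φᵀ * W

theorem precond_eq {Φ : Matrix (Fin m) (Fin n) ℝ} {W : Matrix (Fin m) (Fin m) ℝ}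
    (h : IsUnit (Φᵀ * W * Φ).det) : precond Φ W = (Φᵀ * W * Φ)⁻¹ * Φᵀ * W := by
  rw [precond, pinv_eq_inv h]

/-- The preconditioner is an exact left inverse of `Φ` for every weight `W`; this is what makes the
drift error as small as `Φ - G`. -/
theorem precond_mul {Φ : Matrix (Fin m) (Fin n) ℝ} {W : Matrix (Fin m) (Fin m) ℝ}
    (h : IsUnit (Φᵀ * W * Φ).det) : precond Φ W * Φ = 1 := by
  rw [precond_eq h, Matrix.mul_assoc, Matrix.mul_assoc, ← Matrix.mul_assoc Φᵀ,
    Matrix.nonsing_inv_mul _ h]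

/-- The Moore–Penrose inverse is not continuous in general, but near an invertible Gram matrix it is
the ordinary inverse, which is. -/
theorem tendsto_precond {ι : Type*} {f : Filter ι} {Φ : ι → Matrix (Fin m) (Fin n) ℝ}
    {Φ₀ : Matrix (Fin m) (Fin n) ℝ} {W : ι → Matrix (Fin m) (Fin m) ℝ}
    {W₀ : Matrix (Fin m) (Fin m) ℝ} (hΦ : Tendsto Φ f (𝓝 Φ₀)) (hW : Tendsto W f (𝓝 W₀))
    (h : IsUnit (Φ₀ᵀ * W₀ * Φ₀).det) :
    Tendsto (fun i => precond (Φ i) (W i)) f (𝓝 (precond Φ₀ W₀)) ∧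
      ∀ᶠ i in f, precond (Φ i) (W i) * Φ i = 1 := by
  have hT : Tendsto (fun i => (Φ i)ᵀ) f (𝓝 Φ₀ᵀ) :=
    (continuous_id.matrix_transpose.tendsto Φ₀).comp hΦ
  have hM := tendsto_matrix_mul (tendsto_matrix_mul hT hW) hΦ
  have hev : ∀ᶠ i in f, IsUnit ((Φ i)ᵀ * W i * Φ i).det :=
    (((continuous_id.matrix_det.tendsto _).comp hM).eventually_ne h.ne_zero).mono
      fun i hi => isUnit_iff_ne_zero.2 hi
  refine ⟨?_, hev.mono fun i hi => precond_mul hi⟩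
  rw [precond_eq h]
  exact (tendsto_matrix_mul (tendsto_matrix_mul (tendsto_matrix_inv hM h) hT) hW).congr'
    (hev.mono fun i hi => (precond_eq hi).symm)

end LinearAlgebra

/-! ### Moments of a single observation -/

section Observations

variable {dβ dg : ℕ}

theorem measurable_G : Measurable (Obs.G : Obs dβ dg → _) := by
  refine measurable_matrix_iff.2 fun i j => ?_
  simp only [Obs.G, Obs.z, Obs.x, Matrix.vecMulVec_apply]
  fun_prop

theorem measurable_zz : Measurable (Obs.zz : Obs dβ dg → _) := by
  refine measurable_matrix_iff.2 fun i j => ?_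
  simp only [Obs.zz, Obs.z, Matrix.vecMulVec_apply]
  fun_prop

theorem measurable_g (β : EuclideanSpace ℝ (Fin dβ)) :
    Measurable fun D : Obs dβ dg => D.g β := by
  simp only [Obs.g, Obs.z, Obs.x, Obs.y, dotProduct]
  fun_prop

/-- The moment function is affine in `β`; at `β_*` this turns the algorithm into a linear scheme for
the error. -/
theorem g_add (D : Obs dβ dg) (β δ : EuclideanSpace ℝ (Fin dβ)) :
    D.g (β + δ) = toCLM D.G δ + D.g β := by
  ext i
  simp only [Obs.g, toCLM_apply, Obs.G, Matrix.vecMulVec_mulVec, WithLp.ofLp_add, dotProduct_add,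
    PiLp.add_apply, PiLp.smul_apply, smul_eq_mul, Pi.smul_apply, op_smul_eq_mul]
  ring

theorem abs_apply_le_norm {m n : ℕ} (A : Matrix (Fin m) (Fin n) ℝ) (i : Fin m) (j : Fin n) :
    |A i j| ≤ ‖A‖ := by
  have h1 := (toCLM A).le_opNorm (EuclideanSpace.single j 1)
  rw [norm_toCLM, PiLp.norm_single, norm_one, mul_one] at h1
  refine le_trans ?_ h1
  have h2 := PiLp.norm_apply_le (toCLM A (EuclideanSpace.single j 1)) i
  simpa [toCLM_apply] using h2

theorem memLp_two_of_integrable_norm_sq {α H : Type*} [MeasurableSpace α] [NormedAddCommGroup H]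
    {ν : Measure α} {f : α → H} (hf : AEStronglyMeasurable f ν)
    (h : Integrable (fun y => ‖f y‖ ^ 2) ν) : MemLp f 2 ν :=
  (memLp_two_iff_integrable_sq_norm hf).2 h

variable {μ : Measure (Obs dβ dg)}

theorem memLp_G_apply (hG2 : Integrable (fun D : Obs dβ dg => ‖D.G‖ ^ 2) μ) (i : Fin dg)
    (j : Fin dβ) : MemLp (fun D : Obs dβ dg => D.G i j) 2 μ := by
  have hm := measurable_matrix_iff.1 (measurable_G (dβ := dβ) (dg := dg)) i j
  exact (memLp_two_of_integrable_norm_sq measurable_G.aestronglyMeasurable hG2).mono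
    hm.aestronglyMeasurable (Eventually.of_forall fun D => abs_apply_le_norm D.G i j)

theorem integrable_zz_apply (hz : Integrable (fun D : Obs dβ dg => ‖D.z‖ ^ 2) μ) (i j : Fin dg) :
    Integrable (fun D : Obs dβ dg => D.zz i j) μ := by
  have hm := measurable_matrix_iff.1 (measurable_zz (dβ := dβ) (dg := dg)) i j
  refine hz.mono hm.aestronglyMeasurable (Eventually.of_forall fun D => ?_)
  rw [Real.norm_of_nonneg (sq_nonneg ‖D.z‖), sq]
  simp only [Obs.zz, Matrix.vecMulVec_apply, norm_mul]
  exact mul_le_mul (PiLp.norm_apply_le _ i) (PiLp.norm_apply_le _ j) (norm_nonneg _) (norm_nonneg _)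

theorem memLp_toCLM_G (hG2 : Integrable (fun D : Obs dβ dg => ‖D.G‖ ^ 2) μ) :
    MemLp (fun D : Obs dβ dg => toCLM D.G) 2 μ :=
  memLp_two_of_integrable_norm_sq (measurable_toCLM.comp measurable_G).aestronglyMeasurable
    (by simpa only [norm_toCLM] using hG2)

/-- `popG` is defined entrywise, whereas the scheme wants a Bochner integral of operators; both
integrals commute with the continuous linear entry maps. -/
theorem integral_toCLM_G [IsProbabilityMeasure μ]
    (hG2 : Integrable (fun D : Obs dβ dg => ‖D.G‖ ^ 2) μ) :
    ∫ D : Obs dβ dg, toCLM D.G ∂μ = toCLM (popG μ) := by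
  have hi : Integrable (fun D : Obs dβ dg => D.G) μ :=
    (memLp_two_of_integrable_norm_sq measurable_G.aestronglyMeasurable hG2).integrable one_le_two
  rw [toCLM.integral_comp_comm hi]
  congr 1
  ext i j
  let L : Matrix (Fin dg) (Fin dβ) ℝ →L[ℝ] ℝ :=
    LinearMap.toContinuousLinearMap (Matrix.entryLinearMap ℝ ℝ i j)
  exact (L.integral_comp_comm hi).symm

end Observations

/-! ### Closed forms for the recursions of the algorithm -/

section Run

variable {dβ dg n₀ : ℕ} {η₀ γ₀ a : ℝ} (S₀ : Fin n₀ → Obs dβ dg)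
  (β₀ : EuclideanSpace ℝ (Fin dβ)) (S : ℕ → Obs dβ dg)

/-- The mean of `f` over the initial sample and the first `k` observations. -/
def runningMean {V : Type*} [AddCommGroup V] [Module ℝ V] (f : Obs dβ dg → V) (k : ℕ) : V :=
  ((n₀ : ℝ) + k)⁻¹ • (∑ j, f (S₀ j) + ∑ i ∈ Finset.range k, f (S i))

theorem runningMean_succ {V : Type*} [AddCommGroup V] [Module ℝ V] (hn₀ : 1 ≤ n₀)
    (f : Obs dβ dg → V) (k : ℕ) :
    runningMean S₀ S f (k + 1) = (((n₀ : ℝ) + k) / (n₀ + k + 1)) • runningMean S₀ S f k +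
      (1 / ((n₀ : ℝ) + k + 1)) • f (S k) := by
  have h0 : (1 : ℝ) ≤ n₀ := by exact_mod_cast hn₀
  have h1 : (n₀ : ℝ) + k ≠ 0 := by positivity
  rw [runningMean, runningMean, smul_smul, Finset.sum_range_succ, ← add_assoc, smul_add]
  congr 2
  · push_cast
    field_simp
    ring
  · push_cast
    rw [one_div, ← add_assoc]

theorem run_Φ (hn₀ : 1 ≤ n₀) (k : ℕ) :
    (run η₀ γ₀ a S₀ β₀ S k).Φ = runningMean S₀ S Obs.G k := by
  induction k with
  | zero => simp [run, init, runningMean]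
  | succ k ih =>
    rw [runningMean_succ _ _ hn₀, ← ih]
    simp only [run, step]
    push_cast
    rw [show (n₀ : ℝ) + (k + 1) - 1 = n₀ + k by ring, ← add_assoc]

/-- The matrix whose inverse is `W_k`. -/
def runQ (η₀ : ℝ) (k : ℕ) : Matrix (Fin dg) (Fin dg) ℝ :=
  runningMean S₀ S Obs.zz k + (((n₀ : ℝ) + k)⁻¹ * (n₀ * η₀)) • (1 : Matrix (Fin dg) (Fin dg) ℝ)

theorem runQ_zero (hn₀ : 1 ≤ n₀) : runQ S₀ S η₀ 0 = initQ η₀ S₀ := by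
  have h0 : (1 : ℝ) ≤ n₀ := by exact_mod_cast hn₀
  have h1 : (n₀ : ℝ) ≠ 0 := by positivity
  rw [runQ, initQ, runningMean]
  simp [inv_mul_cancel_left₀ h1]

/-- The ridge term is rescaled like the contribution of the initial sample, so its weight `n₀η₀/(n₀
+ k)` fits the recursion and dies out. -/
theorem runQ_succ (hn₀ : 1 ≤ n₀) (k : ℕ) :
    runQ S₀ S η₀ (k + 1) = (((n₀ : ℝ) + k) / (n₀ + k + 1)) • runQ S₀ S η₀ k +
      (1 / ((n₀ : ℝ) + k + 1)) • (S k).zz := by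
  have h0 : (1 : ℝ) ≤ n₀ := by exact_mod_cast hn₀
  have h1 : (n₀ : ℝ) + k ≠ 0 := by positivity
  rw [runQ, runQ, runningMean_succ _ _ hn₀, smul_add, smul_smul, add_right_comm]
  congr 3
  push_cast
  field_simp
  ring

theorem posSemidef_zz (D : Obs dβ dg) : D.zz.PosSemidef := by
  simpa [Obs.zz] using Matrix.posSemidef_vecMulVec_self_star D.z.ofLp

/-- A positive semidefinite matrix is definite if it is invertible, or once a positive ridge is
added. -/
theorem posDef_initQ (hη₀ : 0 ≤ η₀) (h : η₀ = 0 → IsUnit (initQ η₀ S₀)) :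
    (initQ η₀ S₀).PosDef := by
  have h1 : ((1 / (n₀ : ℝ)) • ∑ j, (S₀ j).zz).PosSemidef :=
    (Matrix.posSemidef_sum _ fun j _ => posSemidef_zz (S₀ j)).smul (by positivity)
  rcases hη₀.eq_or_lt with h0 | h0
  · refine Matrix.PosSemidef.posDef_iff_isUnit ?_ |>.2 (h h0.symm)
    simpa [initQ, ← h0] using h1
  · exact Matrix.PosDef.posSemidef_add h1 (Matrix.PosDef.one.smul h0)

theorem posDef_runQ (hn₀ : 1 ≤ n₀) (h : (initQ η₀ S₀).PosDef) (k : ℕ) :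
    (runQ S₀ S η₀ k).PosDef := by
  have h0 : (1 : ℝ) ≤ n₀ := by exact_mod_cast hn₀
  induction k with
  | zero => rwa [runQ_zero _ _ hn₀]
  | succ k ih =>
    rw [runQ_succ _ _ hn₀]
    exact (ih.smul (by positivity)).add_posSemidef ((posSemidef_zz _).smul (by positivity))

/-- Induction on the Sherman–Morrison identity `inv_running_mean` with `s = n₀ + k`; positive
definiteness persists along the way. -/
theorem run_W (hn₀ : 1 ≤ n₀) (h : (initQ η₀ S₀).PosDef) (k : ℕ) :
    (run η₀ γ₀ a S₀ β₀ S k).W = (runQ S₀ S η₀ k)⁻¹ := by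
  have h0 : (1 : ℝ) ≤ n₀ := by exact_mod_cast hn₀
  induction k with
  | zero => rw [runQ_zero _ _ hn₀]; rfl
  | succ k ih =>
    rw [runQ_succ _ _ hn₀, Obs.zz, ← inv_running_mean (posDef_runQ S₀ S hn₀ h k) (by positivity),
      ← ih]
    simp only [run, step, Obs.zz]
    push_cast
    rw [show (n₀ : ℝ) + (k + 1) - 1 = n₀ + k by ring, ← add_assoc]

theorem run_β_succ (k : ℕ) : (run η₀ γ₀ a S₀ β₀ S (k + 1)).β = (run η₀ γ₀ a S₀ β₀ S k).β -
    (γ₀ * ((k : ℝ) + 1) ^ (-a)) • toCLM (precond (run η₀ γ₀ a S₀ β₀ S k).Φ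
      (run η₀ γ₀ a S₀ β₀ S k).W) ((S k).g (run η₀ γ₀ a S₀ β₀ S k).β) := by
  simp only [run, step, stepβ, toCLM_apply, precond]
  push_cast
  rfl

/-- In the first step the old average gets weight `(1 - 1)/1 = 0`, so `β₀` drops out and the average
runs over `β_1, …, β_k`. -/
theorem smul_run_βbar (k : ℕ) : (k : ℝ) • (run η₀ γ₀ a S₀ β₀ S k).βbar =
    ∑ i ∈ Finset.range k, (run η₀ γ₀ a S₀ β₀ S (i + 1)).β := by
  induction k with
  | zero => simp
  | succ k ih =>
    rw [Finset.sum_range_succ, ← ih]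
    simp only [run, step]
    rw [smul_add, smul_smul, smul_smul]
    have : ((k + 1 : ℕ) : ℝ) ≠ 0 := by positivity
    congr 1
    · congr 1
      field_simp
      push_cast
      ring
    · rw [mul_one_div_cancel this, one_smul]

end Run

/-! ### Measurability of the algorithm -/

section RunMeasurability

variable {Ω : Type*} [MeasurableSpace Ω] {dβ dg n₀ : ℕ} {η₀ γ₀ a : ℝ}
  {S₀ : Fin n₀ → Ω → Obs dβ dg} {S : ℕ → Ω → Obs dβ dg}
  {b : (Fin n₀ → Obs dβ dg) → EuclideanSpace ℝ (Fin dβ)}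

theorem measurable_precond {m n : ℕ} {Φ : Ω → Matrix (Fin m) (Fin n) ℝ}
    {W : Ω → Matrix (Fin m) (Fin m) ℝ} (hΦ : Measurable Φ) (hW : Measurable W) :
    Measurable fun ω => precond (Φ ω) (W ω) :=
  measurable_matrix_mul (measurable_matrix_mul (measurable_pinv.comp (measurable_matrix_mul
    (measurable_matrix_mul (measurable_matrix_transpose hΦ) hW) hΦ))
    (measurable_matrix_transpose hΦ)) hW

theorem measurable_clm_apply {E F : Type*} [NormedAddCommGroup E] [InnerProductSpace ℝ E]
    [FiniteDimensional ℝ E] [MeasurableSpace E] [BorelSpace E] [NormedAddCommGroup F]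
    [InnerProductSpace ℝ F] [FiniteDimensional ℝ F] [MeasurableSpace F] [BorelSpace F]
    {L : Ω → E →L[ℝ] F} {v : Ω → E} (hL : Measurable L) (hv : Measurable v) :
    Measurable fun ω => L ω (v ω) :=
  ContinuousLinearMap.measurable_apply₂.comp (hL.prodMk hv)

theorem measurable_congr {β : Type*} [MeasurableSpace β] {f g : Ω → β} (h : ∀ ω, f ω = g ω) :
    Measurable f ↔ Measurable g := by rw [funext h]

/-- The state after `k` steps is a Borel function of the initial sample and the first `k`
observations. -/
theorem measurable_run (hS₀ : ∀ j, Measurable (S₀ j)) (hb : Measurable b) (k : ℕ)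
    (hS : ∀ i < k, Measurable (S i)) :
    Measurable (fun ω => (run η₀ γ₀ a (fun j => S₀ j ω) (b fun j => S₀ j ω) (fun i => S i ω) k).β) ∧
    Measurable (fun ω => (run η₀ γ₀ a (fun j => S₀ j ω) (b fun j => S₀ j ω) (fun i => S i ω) k).Φ) ∧
    Measurable (fun ω => (run η₀ γ₀ a (fun j => S₀ j ω) (b fun j => S₀ j ω) (fun i => S i ω) k).W) ∧
    Measurable (fun ω =>
      (run η₀ γ₀ a (fun j => S₀ j ω) (b fun j => S₀ j ω) (fun i => S i ω) k).βbar) := by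
  -- Only the observations before time `k` are assumed measurable, so the σ-algebra may be taken to
  -- be `past S₀ S k`.
  induction k with
  | zero =>
    have h0 : Measurable fun ω => b fun j => S₀ j ω :=
      hb.comp (measurable_pi_lambda _ hS₀)
    refine ⟨h0, ?_, ?_, h0⟩
    · refine measurable_matrix_iff.2 fun i j => ?_
      have (l : Fin n₀) : Measurable fun ω => (S₀ l ω).G i j :=
        (measurable_matrix_iff.1 measurable_G i j).comp (hS₀ l)
      simp only [run, init, Matrix.smul_apply, Matrix.sum_apply]
      fun_prop
    · refine measurable_matrix_inv (measurable_matrix_iff.2 fun i j => ?_)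
      have (l : Fin n₀) : Measurable fun ω => (S₀ l ω).zz i j :=
        (measurable_matrix_iff.1 measurable_zz i j).comp (hS₀ l)
      simp only [initQ, Matrix.add_apply, Matrix.smul_apply, Matrix.sum_apply]
      fun_prop
  | succ k ih =>
    obtain ⟨hβ, hΦ, hW, hβb⟩ := ih fun i hi => hS i (hi.trans k.lt_succ_self)
    have hSk := hS k k.lt_succ_self
    have hz : Measurable fun ω => (S k ω).zz := measurable_zz.comp hSk
    have hGk : Measurable fun ω => (S k ω).G := measurable_G.comp hSk
    have hg : Measurable fun ω => (S k ω).g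
        (run η₀ γ₀ a (fun j => S₀ j ω) (b fun j => S₀ j ω) (fun i => S i ω) k).β := by
      have h1 : Measurable fun ω => toCLM (S k ω).G
          (run η₀ γ₀ a (fun j => S₀ j ω) (b fun j => S₀ j ω) (fun i => S i ω) k).β :=
        measurable_clm_apply (measurable_toCLM.comp hGk) hβ
      have h2 : Measurable fun ω => (S k ω).g 0 := (measurable_g 0).comp hSk
      refine (measurable_congr fun ω => ?_).1 (h1.fun_add h2)
      rw [← g_add, zero_add]
    have hβ' : Measurable fun ω =>
        (run η₀ γ₀ a (fun j => S₀ j ω) (b fun j => S₀ j ω) (fun i => S i ω) (k + 1)).β := by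
      have h1 : Measurable fun ω => toCLM (precond
          (run η₀ γ₀ a (fun j => S₀ j ω) (b fun j => S₀ j ω) (fun i => S i ω) k).Φ
          (run η₀ γ₀ a (fun j => S₀ j ω) (b fun j => S₀ j ω) (fun i => S i ω) k).W)
          ((S k ω).g (run η₀ γ₀ a (fun j => S₀ j ω) (b fun j => S₀ j ω) (fun i => S i ω) k).β) :=
        measurable_clm_apply (measurable_toCLM.comp (measurable_precond hΦ hW)) hg
      simp only [run_β_succ]
      fun_prop
    refine ⟨hβ', ?_, ?_, ?_⟩
    · simp only [run, step]
      fun_prop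
    · have hzv : Measurable fun ω => (S k ω).z.ofLp := by
        simp only [Obs.z]
        fun_prop
      have hW' := measurable_matrix_iff.1 hW
      have hm : Measurable fun ω => (n₀ : ℝ) + (k + 1 : ℕ) - 1 + (S k ω).z.ofLp ⬝ᵥ
          ((run η₀ γ₀ a (fun j => S₀ j ω) (b fun j => S₀ j ω) (fun i => S i ω) k).W *ᵥ
            (S k ω).z.ofLp) := by
        simp only [dotProduct, Matrix.mulVec]
        fun_prop
      have h2 : Measurable fun ω => 1 - ((n₀ : ℝ) + (k + 1 : ℕ) - 1 + (S k ω).z.ofLp ⬝ᵥ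
          ((run η₀ γ₀ a (fun j => S₀ j ω) (b fun j => S₀ j ω) (fun i => S i ω) k).W *ᵥ
            (S k ω).z.ofLp))⁻¹ • ((S k ω).zz *
            (run η₀ γ₀ a (fun j => S₀ j ω) (b fun j => S₀ j ω) (fun i => S i ω) k).W) :=
        (hm.fun_inv.fun_smul (measurable_matrix_mul hz hW)).const_sub 1
      simp only [run, step]
      exact (measurable_matrix_mul hW h2).fun_const_smul _
    · simp only [run, step] at hβ' ⊢
      fun_prop

end RunMeasurability

/-! ### Law of large numbers and variance of the running means -/

section Sampling

variable {Ω : Type*} [MeasurableSpace Ω] {P : Measure Ω} [IsProbabilityMeasure P]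
  {dβ dg n₀ : ℕ} {μ : Measure (Obs dβ dg)}
  {S : ℕ → Ω → Obs dβ dg} {S₀ : Fin n₀ → Ω → Obs dβ dg}

theorem identDistrib_of_law {α : Type*} [MeasurableSpace α] {ν : Measure α} {X X' : Ω → α}
    (hX : Measurable X) (hX' : Measurable X') (h : P.map X = ν) (h' : P.map X' = ν) :
    IdentDistrib X X' P P := ⟨hX.aemeasurable, hX'.aemeasurable, h.trans h'.symm⟩

/-- The strong law of large numbers for the running means. -/
theorem ae_tendsto_runningMean (hS_meas : ∀ i, Measurable (S i)) (hS_law : ∀ i, P.map (S i) = μ)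
    (h_indep : iIndepFun S P) {f : Obs dβ dg → ℝ} (hf : Measurable f) (hfi : Integrable f μ) :
    ∀ᵐ ω ∂P, Tendsto (fun k => runningMean (fun j => S₀ j ω) (fun i => S i ω) f k) atTop
      (𝓝 (∫ D, f D ∂μ)) := by
  have h1 := strong_law_ae_real (fun i ω => f (S i ω))
    ((integrable_map_measure (by rw [hS_law]; exact hfi.aestronglyMeasurable)
      (hS_meas 0).aemeasurable).1 (by rwa [hS_law]))
    (fun i j hij => (h_indep.indepFun hij).comp hf hf)
    (fun i => (identDistrib_of_law (hS_meas i) (hS_meas 0) (hS_law i) (hS_law 0)).comp hf)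
  have h2 : ∫ ω, f (S 0 ω) ∂P = ∫ D, f D ∂μ := by
    rw [← hS_law 0, integral_map (hS_meas 0).aemeasurable
      (by rw [hS_law]; exact hfi.aestronglyMeasurable)]
  rw [h2] at h1
  filter_upwards [h1] with ω hω
  have hk : Tendsto (fun k : ℕ => (n₀ : ℝ) + k) atTop atTop :=
    tendsto_atTop_add_const_left _ _ tendsto_natCast_atTop_atTop
  have h3 : Tendsto (fun k : ℕ => ((n₀ : ℝ) + k)⁻¹) atTop (𝓝 0) := tendsto_inv_atTop_zero.comp hk
  have h4 : Tendsto (fun k : ℕ => 1 - ((n₀ : ℝ) + k)⁻¹ * n₀) atTop (𝓝 1) := by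
    simpa using (h3.mul_const (n₀ : ℝ)).const_sub 1
  -- The fixed initial sum is washed out, and the mean of the first `k` observations enters with
  -- weight `k/(n₀ + k) → 1`.
  have h5 := (h3.mul_const (∑ j, f (S₀ j ω))).add (h4.mul hω)
  rw [zero_mul, zero_add, one_mul] at h5
  refine h5.congr' ?_
  filter_upwards [eventually_ge_atTop 1] with k hk
  have hk' : (1 : ℝ) ≤ k := by exact_mod_cast hk
  have : (n₀ : ℝ) + k ≠ 0 := by positivity
  simp only [runningMean, smul_eq_mul]
  field_simp
  ring

/-- The variance of the running means. -/
theorem lintegral_runningMean_sub_sq_le (hn₀ : 1 ≤ n₀) (hS_meas : ∀ i, Measurable (S i))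
    (hS₀_meas : ∀ j, Measurable (S₀ j)) (hS_law : ∀ i, P.map (S i) = μ)
    (hS₀_law : ∀ j, P.map (S₀ j) = μ) (h_indep : iIndepFun (Sum.elim S₀ S) P)
    {f : Obs dβ dg → ℝ} (hf : Measurable f) (hfi : MemLp f 2 μ) (k : ℕ) :
    ∫⁻ ω, ENNReal.ofReal ((runningMean (fun j => S₀ j ω) (fun i => S i ω) f k -
      ∫ D, f D ∂μ) ^ 2) ∂P ≤ ENNReal.ofReal (Var[f; μ] / ((k : ℝ) + 1)) := by
  set Z : Fin n₀ ⊕ ℕ → Ω → ℝ := fun i ω => f (Sum.elim S₀ S i ω) with hZ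
  have hμ : IsProbabilityMeasure μ :=
    hS_law 0 ▸ Measure.isProbabilityMeasure_map (hS_meas 0).aemeasurable
  have hm : ∀ i, Measurable (Sum.elim S₀ S i) := by rintro (j | i) <;> simp [hS_meas, hS₀_meas]
  have hl : ∀ i, P.map (Sum.elim S₀ S i) = μ := by rintro (j | i) <;> simp [hS_law, hS₀_law]
  have hZm : ∀ i, Measurable (Z i) := fun i => hf.comp (hm i)
  have hZ2 : ∀ i, MemLp (Z i) 2 P := fun i =>
    (by rwa [hl i] : MemLp f 2 (P.map (Sum.elim S₀ S i))).comp_of_map (hm i).aemeasurable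
  have hZI : ∀ i, ∫ ω, Z i ω ∂P = ∫ D, f D ∂μ := fun i => by
    rw [← hl i, integral_map (hm i).aemeasurable hf.aestronglyMeasurable]
  have hZv : ∀ i, Var[Z i; P] = Var[f; μ] := fun i => by
    rw [← hl i, variance_map hf.aemeasurable (hm i).aemeasurable]; rfl
  set s : Finset (Fin n₀ ⊕ ℕ) := Finset.univ.disjSum (Finset.range k) with hs
  have hvar := IndepFun.variance_sum (s := s) (fun i _ => hZ2 i)
    (fun i _ j _ hij => (h_indep.indepFun hij).comp hf hf)
  have hcard : (s.card : ℝ) = n₀ + k := by simp [hs]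
  simp_rw [hZv] at hvar
  rw [Finset.sum_const, nsmul_eq_mul, hcard] at hvar
  have h0 : (1 : ℝ) ≤ n₀ := by exact_mod_cast hn₀
  have hpos : (n₀ : ℝ) + k ≠ 0 := by positivity
  have hR : ∀ ω, runningMean (fun j => S₀ j ω) (fun i => S i ω) f k =
      (((n₀ : ℝ) + k)⁻¹ • ∑ i ∈ s, Z i) ω := fun ω => by
    simp [runningMean, hs, hZ, Finset.sum_disjSum, Finset.sum_apply]
  have hR2 : MemLp (((n₀ : ℝ) + k)⁻¹ • ∑ i ∈ s, Z i) 2 P :=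
    (memLp_finsetSum' s fun i _ => hZ2 i).const_smul _
  have hRm : AEMeasurable (((n₀ : ℝ) + k)⁻¹ • ∑ i ∈ s, Z i) P := hR2.aestronglyMeasurable.aemeasurable
  have hRI : ∫ ω, (((n₀ : ℝ) + k)⁻¹ • ∑ i ∈ s, Z i) ω ∂P = ∫ D, f D ∂μ := by
    simp only [Pi.smul_apply, Finset.sum_apply, smul_eq_mul]
    rw [integral_const_mul, integral_finsetSum s fun i _ => (hZ2 i).integrable one_le_two]
    simp_rw [hZI]
    rw [Finset.sum_const, nsmul_eq_mul, hcard, inv_mul_cancel_left₀ hpos]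
  have hV : Var[((n₀ : ℝ) + k)⁻¹ • ∑ i ∈ s, Z i; P] = Var[f; μ] / (n₀ + k) := by
    rw [variance_smul, hvar]
    field_simp
  rw [variance_eq_integral hRm, hRI] at hV
  simp_rw [hR]
  have hsq : Integrable (fun ω => ((((n₀ : ℝ) + k)⁻¹ • ∑ i ∈ s, Z i) ω - ∫ D, f D ∂μ) ^ 2) P :=
    (hR2.sub (memLp_const (∫ D, f D ∂μ))).integrable_sq
  rw [← ofReal_integral_eq_lintegral_ofReal hsq
    (Eventually.of_forall fun _ => by positivity), hV]
  -- `n₀ ≥ 1` allows `n₀ + k` to be replaced by `k + 1`.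
  refine ENNReal.ofReal_le_ofReal (div_le_div_of_nonneg_left (variance_nonneg _ _) (by positivity)
    (by linarith))

theorem runningMean_apply {m n : ℕ} (A : Obs dβ dg → Matrix (Fin m) (Fin n) ℝ)
    (s₀ : Fin n₀ → Obs dβ dg) (s : ℕ → Obs dβ dg) (k : ℕ) (i : Fin m) (j : Fin n) :
    runningMean s₀ s A k i j = runningMean s₀ s (fun D => A D i j) k := by
  simp [runningMean, Matrix.sum_apply]

theorem ae_tendsto_runningMean_matrix (hS_meas : ∀ i, Measurable (S i))
    (hS_law : ∀ i, P.map (S i) = μ) (h_indep : iIndepFun S P) {m n : ℕ}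
    {A : Obs dβ dg → Matrix (Fin m) (Fin n) ℝ} (hA : Measurable A)
    (hAi : ∀ i j, Integrable (fun D => A D i j) μ) :
    ∀ᵐ ω ∂P, Tendsto (fun k => runningMean (fun j => S₀ j ω) (fun i => S i ω) A k) atTop
      (𝓝 (Matrix.of fun i j => ∫ D, A D i j ∂μ)) := by
  have h : ∀ᵐ ω ∂P, ∀ i j, Tendsto (fun k => runningMean (fun j => S₀ j ω) (fun i => S i ω)
      (fun D => A D i j) k) atTop (𝓝 (∫ D, A D i j ∂μ)) :=
    ae_all_iff.2 fun i => ae_all_iff.2 fun j =>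
      ae_tendsto_runningMean hS_meas hS_law h_indep (measurable_matrix_iff.1 hA i j) (hAi i j)
  filter_upwards [h] with ω hω
  refine tendsto_pi_nhds.2 fun i => tendsto_pi_nhds.2 fun j => ?_
  simpa only [runningMean_apply, Matrix.of_apply] using hω i j

/-- The mean square error of the running mean of `z x'`. -/
theorem exists_lintegral_runningMean_G_le (hn₀ : 1 ≤ n₀) (hS_meas : ∀ i, Measurable (S i))
    (hS₀_meas : ∀ j, Measurable (S₀ j)) (hS_law : ∀ i, P.map (S i) = μ)
    (hS₀_law : ∀ j, P.map (S₀ j) = μ) (h_indep : iIndepFun (Sum.elim S₀ S) P)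
    (hG2 : Integrable (fun D : Obs dβ dg => ‖D.G‖ ^ 2) μ) :
    ∃ c : ℝ, 0 ≤ c ∧ ∀ k : ℕ,
      ∫⁻ ω, ‖runningMean (fun j => S₀ j ω) (fun i => S i ω) Obs.G k - popG μ‖ₑ ^ 2 ∂P ≤
        ENNReal.ofReal (c / ((k : ℝ) + 1)) := by
  obtain ⟨c, hc, hcA⟩ := exists_norm_sq_le_sum_sq dg dβ
  refine ⟨c * ∑ i, ∑ j, Var[fun D : Obs dβ dg => D.G i j; μ], mul_nonneg hc
    (Finset.sum_nonneg fun i _ => Finset.sum_nonneg fun j _ => variance_nonneg _ _), fun k => ?_⟩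
  have hGm := measurable_matrix_iff.1 (measurable_G (dβ := dβ) (dg := dg))
  have hmeas : ∀ i j, Measurable fun ω => ENNReal.ofReal ((runningMean (fun j => S₀ j ω)
      (fun i => S i ω) (fun D => D.G i j) k - ∫ D, D.G i j ∂μ) ^ 2) := fun i j => by
    have h1 (l : Fin n₀) : Measurable fun ω => (S₀ l ω).G i j := (hGm i j).comp (hS₀_meas l)
    have h2 (l : ℕ) : Measurable fun ω => (S l ω).G i j := (hGm i j).comp (hS_meas l)
    simp only [runningMean]
    fun_prop
  calc _ ≤ ∫⁻ ω, ENNReal.ofReal c * ∑ i, ∑ j, ENNReal.ofReal ((runningMean (fun j => S₀ j ω)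
        (fun i => S i ω) (fun D => D.G i j) k - ∫ D, D.G i j ∂μ) ^ 2) ∂P := by
        refine lintegral_mono fun ω => ?_
        rw [enorm_sq_eq_ofReal]
        have hle := hcA (runningMean (fun j => S₀ j ω) (fun i => S i ω) Obs.G k - popG μ)
        simp only [Matrix.sub_apply, runningMean_apply, popG, Matrix.of_apply] at hle
        refine (ENNReal.ofReal_le_ofReal hle).trans (le_of_eq ?_)
        rw [ENNReal.ofReal_mul hc, ENNReal.ofReal_sum_of_nonneg fun i _ =>
          Finset.sum_nonneg fun j _ => sq_nonneg _]
        congr 1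
        exact Finset.sum_congr rfl fun i _ =>
          ENNReal.ofReal_sum_of_nonneg fun j _ => sq_nonneg _
    _ = ENNReal.ofReal c * ∑ i, ∑ j, ∫⁻ ω, ENNReal.ofReal ((runningMean (fun j => S₀ j ω)
        (fun i => S i ω) (fun D => D.G i j) k - ∫ D, D.G i j ∂μ) ^ 2) ∂P := by
        rw [lintegral_const_mul _ (Finset.measurable_fun_sum _ fun i _ =>
          Finset.measurable_fun_sum _ fun j _ => hmeas i j),
          lintegral_finsetSum _ fun i _ => Finset.measurable_fun_sum _ fun j _ => hmeas i j]
        congr 1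
        exact Finset.sum_congr rfl fun i _ => lintegral_finsetSum _ fun j _ => hmeas i j
    _ ≤ ENNReal.ofReal c * ∑ i, ∑ j, ENNReal.ofReal
        (Var[fun D : Obs dβ dg => D.G i j; μ] / ((k : ℝ) + 1)) := by
        gcongr with i _ j _
        exact lintegral_runningMean_sub_sq_le hn₀ hS_meas hS₀_meas hS_law hS₀_law h_indep
          (hGm i j) (memLp_G_apply hG2 i j) k
    _ = _ := by
        have hnn : ∀ i j, 0 ≤ Var[fun D : Obs dβ dg => D.G i j; μ] / ((k : ℝ) + 1) := fun i j =>
          div_nonneg (variance_nonneg _ _) (by positivity)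
        rw [mul_div_assoc, ENNReal.ofReal_mul hc, Finset.sum_div]
        simp_rw [Finset.sum_div]
        rw [ENNReal.ofReal_sum_of_nonneg fun i _ => Finset.sum_nonneg fun j _ => hnn i j]
        congr 1
        exact Finset.sum_congr rfl fun i _ =>
          (ENNReal.ofReal_sum_of_nonneg fun j _ => hnn i j).symm

end Sampling

/-! ### Reduction to events of probability close to one -/

section Localization

variable {Ω : Type*} [MeasurableSpace Ω] {P : Measure Ω} [IsProbabilityMeasure P]
  {E : Type*} [NormedAddCommGroup E]

/-- If almost every point eventually lies in the sets `A n`, then the probability of the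
complements tends to zero. -/
theorem exists_measure_compl_le {A : ℕ → Set Ω} (hA : ∀ n, MeasurableSet (A n))
    (h : ∀ᵐ ω ∂P, ∀ᶠ n in atTop, ω ∈ A n) {ε : ENNReal} (hε : 0 < ε) :
    ∀ᶠ n in atTop, P (A n)ᶜ ≤ ε := by
  have h1 := tendsto_measure_of_ae_tendsto_indicator_of_isFiniteMeasure (μ := P) atTop
    MeasurableSet.empty (As := fun n => (A n)ᶜ) (fun n => (hA n).compl)
    (h.mono fun ω hω => hω.mono fun n hn => by simp [hn])
  rw [measure_empty] at h1
  exact ENNReal.tendsto_nhds_zero.1 h1 ε hε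

/-- Convergence in probability to zero may be checked on events of probability close to one, up to
a shift of time and terms of the order `1 / √n`. -/
theorem tendstoInMeasure_zero_of_localization {R : ℕ → Ω → E}
    (h : ∀ ε : ENNReal, 0 < ε → ∃ (A : Set Ω) (N : ℕ) (c : Ω → ℝ) (Y : ℕ → Ω → E), P Aᶜ ≤ ε ∧
      Measurable c ∧ TendstoInMeasure P Y atTop (fun _ => 0) ∧
      ∀ n, N ≤ n → ∀ ω ∈ A, ‖R n ω‖ ≤ (√(n : ℝ))⁻¹ * c ω + ‖Y (n - N) ω‖) :
    TendstoInMeasure P R atTop (fun _ => 0) := by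
  rw [tendstoInMeasure_iff_norm]
  intro η hη
  rw [ENNReal.tendsto_nhds_zero]
  intro ε hε
  have hε3 : 0 < ε / 3 := ENNReal.div_pos hε.ne' (by norm_num)
  obtain ⟨A, N, c, Y, hA, hc, hY, hR⟩ := h (ε / 3) hε3
  have h1 : ∀ᶠ n : ℕ in atTop, P {ω | (√(n : ℝ))⁻¹ * c ω < η / 2}ᶜ ≤ ε / 3 := by
    refine exists_measure_compl_le (fun n => measurableSet_lt (hc.const_mul _) measurable_const)
      (Eventually.of_forall fun ω => ?_) hε3
    have : Tendsto (fun n : ℕ => (√(n : ℝ))⁻¹ * c ω) atTop (𝓝 (0 * c ω)) :=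
      (tendsto_inv_atTop_zero.comp
        (Real.tendsto_sqrt_atTop.comp tendsto_natCast_atTop_atTop)).mul_const _
    rw [zero_mul] at this
    exact this.eventually_lt_const (half_pos hη)
  have h2 : ∀ᶠ n : ℕ in atTop, P {ω | η / 2 ≤ ‖Y (n - N) ω‖} ≤ ε / 3 := by
    have := (tendstoInMeasure_iff_norm.1 hY) (η / 2) (half_pos hη)
    simp only [sub_zero] at this
    exact (tendsto_sub_atTop_nat N).eventually (ENNReal.tendsto_nhds_zero.1 this (ε / 3) hε3)
  filter_upwards [h1, h2, eventually_ge_atTop N] with n hn1 hn2 hnN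
  have hsub : {ω | η ≤ ‖R n ω - 0‖} ⊆ Aᶜ ∪ {ω | (√(n : ℝ))⁻¹ * c ω < η / 2}ᶜ ∪
      {ω | η / 2 ≤ ‖Y (n - N) ω‖} := by
    intro ω hω
    by_contra hcon
    simp only [Set.mem_union, Set.mem_compl_iff, Set.mem_ofPred_eq, not_or, not_not, not_le]
      at hcon hω
    rw [sub_zero] at hω
    have := hR n hnN ω hcon.1.1
    linarith [hcon.1.2, hcon.2]
  calc _ ≤ P (Aᶜ ∪ {ω | (√(n : ℝ))⁻¹ * c ω < η / 2}ᶜ ∪ {ω | η / 2 ≤ ‖Y (n - N) ω‖}) :=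
        measure_mono hsub
    _ ≤ P Aᶜ + P {ω | (√(n : ℝ))⁻¹ * c ω < η / 2}ᶜ + P {ω | η / 2 ≤ ‖Y (n - N) ω‖} :=
        (measure_union_le _ _).trans (by gcongr; exact measure_union_le _ _)
    _ ≤ ε / 3 + ε / 3 + ε / 3 := by gcongr
    _ = ε := ENNReal.add_thirds ε

end Localization

/-! ### Multivariate central limit theorem -/

section CentralLimit

variable {Ω : Type*} [MeasurableSpace Ω] {P : Measure Ω} [IsProbabilityMeasure P] {d : ℕ}

/-- The multivariate central limit theorem. -/
theorem tendstoInDistribution_multivariateGaussian {X : ℕ → Ω → EuclideanSpace ℝ (Fin d)}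
    (hX : ∀ i, Measurable (X i)) (hX2 : MemLp (X 0) 2 P) (hindep : iIndepFun X P)
    (hident : ∀ i, IdentDistrib (X i) (X 0) P P) (h0 : ∫ ω, X 0 ω ∂P = 0)
    {V : Matrix (Fin d) (Fin d) ℝ} (hV : V.PosSemidef)
    (hvar : ∀ t : EuclideanSpace ℝ (Fin d),
      Var[fun ω => inner ℝ (X 0 ω) t; P] = t.ofLp ⬝ᵥ (V *ᵥ t.ofLp)) :
    TendstoInDistribution (fun (n : ℕ) ω => (√(n : ℝ))⁻¹ • ∑ k ∈ Finset.range n, X k ω) atTop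
      (id : EuclideanSpace ℝ (Fin d) → _) (fun _ => P) (multivariateGaussian 0 V) where
  forall_aemeasurable n :=
    ((Finset.measurable_fun_sum _ fun k _ => hX k).fun_const_smul _).aemeasurable
  tendsto := by
    refine ProbabilityMeasure.tendsto_iff_tendsto_charFun.2 fun t => ?_
    have hin : Measurable fun v : EuclideanSpace ℝ (Fin d) => inner ℝ v t := by fun_prop
    have hint : ∫ ω, inner ℝ (X 0 ω) t ∂P = 0 := by
      simp_rw [real_inner_comm t]
      rw [integral_inner (hX2.integrable one_le_two), h0, inner_zero_right]
    have hclt := tendstoInDistribution_inv_sqrt_mul_sum_sub (P := P)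
      (X := fun i ω => inner ℝ (X i ω) t)
      (Y := (id : ℝ → ℝ)) (P' := gaussianReal 0 Var[fun ω => inner ℝ (X 0 ω) t; P].toNNReal)
      ⟨aemeasurable_id, Measure.map_id⟩ (hX2.inner_const t)
      (hindep.comp (fun _ v => inner ℝ v t) fun _ => hin)
      (fun i => (hident i).comp hin)
    -- Cramér–Wold: the characteristic function of a vector at `t` is that of its inner product with
    -- `t`, at `1`.
    have hlim := ProbabilityMeasure.tendsto_iff_tendsto_charFun.1 hclt.tendsto 1
    simp only [ProbabilityMeasure.coe_mk, Measure.map_id] at hlim ⊢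
    rw [charFun_multivariateGaussian hV, ← hvar t]
    rw [charFun_gaussianReal] at hlim
    have hr : Complex.exp ((inner ℝ t (0 : EuclideanSpace ℝ (Fin d)) : ℝ) * Complex.I -
        (Var[fun ω => inner ℝ (X 0 ω) t; P] : ℝ) / 2) = Complex.exp ((1 : ℝ) * (0 : ℝ) * Complex.I -
        (Var[fun ω => inner ℝ (X 0 ω) t; P].toNNReal : ℝ) * (1 : ℝ) ^ 2 / 2) := by
      rw [Real.coe_toNNReal _ (variance_nonneg _ _)]
      simp
    rw [hr]
    convert hlim using 2 with n
    rw [charFun_apply, charFun_apply, integral_map, integral_map]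
    · congr 1
      ext ω
      congr 2
      simp [hint, inner_smul_left, sum_inner]
    · exact (((Finset.measurable_fun_sum _ fun k _ => hin.comp (hX k)).sub_const
        _).const_mul _).aemeasurable
    · fun_prop
    · exact ((Finset.measurable_fun_sum _ fun k _ => hX k).fun_const_smul _).aemeasurable
    · fun_prop

end CentralLimit

/-! ### The filtration of the observations -/

section Past

variable {Ω : Type*} {dβ dg n₀ : ℕ} (S₀ : Fin n₀ → Ω → Obs dβ dg) (S : ℕ → Ω → Obs dβ dg)

/-- The information in the initial sample and the first `k` observations. -/
@[reducible] def past (k : ℕ) : MeasurableSpace Ω :=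
  ⨆ i ∈ {i : Fin n₀ ⊕ ℕ | ∀ l, i = Sum.inr l → l < k},
    MeasurableSpace.comap (Sum.elim S₀ S i) inferInstance

theorem past_mono : Monotone (past S₀ S) := fun _ _ h =>
  biSup_mono fun _ hi l hl => (hi l hl).trans_le h

theorem measurable_past_init (k : ℕ) (j : Fin n₀) : Measurable[past S₀ S k] (S₀ j) := by
  rw [measurable_iff_comap_le]
  exact le_iSup₂_of_le (f := fun i (_ : i ∈ {i : Fin n₀ ⊕ ℕ | ∀ l, i = Sum.inr l → l < k}) =>
    MeasurableSpace.comap (Sum.elim S₀ S i) inferInstance) (Sum.inl j) (by simp) le_rfl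

theorem measurable_past {k i : ℕ} (h : i < k) : Measurable[past S₀ S k] (S i) := by
  rw [measurable_iff_comap_le]
  exact le_iSup₂_of_le (f := fun i (_ : i ∈ {i : Fin n₀ ⊕ ℕ | ∀ l, i = Sum.inr l → l < k}) =>
    MeasurableSpace.comap (Sum.elim S₀ S i) inferInstance) (Sum.inr i) (by simpa using h) le_rfl

variable [MeasurableSpace Ω] {P : Measure Ω} {S₀ S}

theorem past_le (hS₀ : ∀ j, Measurable (S₀ j)) (hS : ∀ i, Measurable (S i)) (k : ℕ) :
    past S₀ S k ≤ ‹MeasurableSpace Ω› := by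
  refine iSup₂_le fun i _ => ?_
  rcases i with j | i
  · exact (hS₀ j).comap_le
  · exact (hS i).comap_le

/-- The past and observation `k` are generated by disjoint sets of indices of one independent
family. -/
theorem indep_past (hS₀ : ∀ j, Measurable (S₀ j)) (hS : ∀ i, Measurable (S i))
    (h : iIndepFun (Sum.elim S₀ S) P) (k : ℕ) :
    Indep (past S₀ S k) (MeasurableSpace.comap (S k) inferInstance) P := by
  have hle : ∀ i, MeasurableSpace.comap (Sum.elim S₀ S i) inferInstance ≤ ‹MeasurableSpace Ω› := by
    rintro (j | i)
    · exact (hS₀ j).comap_le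
    · exact (hS i).comap_le
  have h1 := indep_iSup_of_disjoint hle h
    (S := {i : Fin n₀ ⊕ ℕ | ∀ l, i = Sum.inr l → l < k}) (T := {Sum.inr k})
    (by simp)
  simpa only [past, Set.mem_singleton_iff, iSup_iSup_eq_left, Sum.elim_inr] using h1

end Past

/-! ### The scheme for given preconditioners -/

section ErrorProcess

variable {Ω 𝓨 E F : Type*} [NormedAddCommGroup E] [NormedSpace ℝ E]
  [NormedAddCommGroup F] [NormedSpace ℝ F]

/-- The errors of a linear stochastic approximation scheme. -/
def errorProcess (Y : ℕ → Ω → 𝓨) (T : 𝓨 → E →L[ℝ] F) (e : 𝓨 → F) (γ : ℕ → ℝ)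
    (B : ℕ → Ω → F →L[ℝ] E) (δ₀ : Ω → E) : ℕ → Ω → E
  | 0 => δ₀
  | k + 1 => fun ω => errorProcess Y T e γ B δ₀ k ω -
      γ k • B k ω (T (Y k ω) (errorProcess Y T e γ B δ₀ k ω) + e (Y k ω))

end ErrorProcess

/-! ### Asymptotic linearity of the algorithm -/

section Main

variable {Ω : Type*} {dβ dg n₀ : ℕ}

/-- The state of the algorithm on the sample, started from the estimate `b` of the initial
sample. -/
def sampleRun (η₀ γ₀ a : ℝ) (b : (Fin n₀ → Obs dβ dg) → EuclideanSpace ℝ (Fin dβ))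
    (S₀ : Fin n₀ → Ω → Obs dβ dg) (S : ℕ → Ω → Obs dβ dg) (k : ℕ) (ω : Ω) : State dβ dg :=
  run η₀ γ₀ a (fun j => S₀ j ω) (b fun j => S₀ j ω) (fun i => S i ω) k

/-- The preconditioner in step `k + 1`. -/
def samplePrecond (η₀ γ₀ a : ℝ) (b : (Fin n₀ → Obs dβ dg) → EuclideanSpace ℝ (Fin dβ))
    (S₀ : Fin n₀ → Ω → Obs dβ dg) (S : ℕ → Ω → Obs dβ dg) (k : ℕ) (ω : Ω) :
    Matrix (Fin dβ) (Fin dg) ℝ :=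
  precond (sampleRun η₀ γ₀ a b S₀ S k ω).Φ (sampleRun η₀ γ₀ a b S₀ S k ω).W

/-- Since `kγ_k → ∞`, the factor `√γ_{k+1} √(k+1)` in `tendsto_inv_sub` is eventually at least one.
-/
theorem IsLearningRate.tendsto_inv_sub_zero {γ : ℕ → ℝ} (h : IsLearningRate γ) :
    Tendsto (fun k => (γ (k + 1))⁻¹ - (γ k)⁻¹) atTop (𝓝 0) := by
  have h1 : ∀ᶠ k : ℕ in atTop, 1 ≤ ((k + 1 : ℕ) : ℝ) * γ (k + 1) :=
    (h.tendsto_mul.comp (tendsto_add_atTop_nat 1)).eventually_ge_atTop 1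
  refine squeeze_zero' (Eventually.of_forall fun k => sub_nonneg.2 (h.inv_mono k)) ?_
    h.tendsto_inv_sub
  filter_upwards [h1] with k hk
  have h2 : 1 ≤ √(γ (k + 1)) * √((k : ℝ) + 1) := by
    rw [← Real.sqrt_mul (h.pos _).le, Real.one_le_sqrt, mul_comm]
    exact_mod_cast hk
  rw [mul_assoc]
  exact le_mul_of_one_le_right (sub_nonneg.2 (h.inv_mono k)) h2

variable [MeasurableSpace Ω] {P : Measure Ω} [IsProbabilityMeasure P]
  {μ : Measure (Obs dβ dg)} {S : ℕ → Ω → Obs dβ dg} {S₀ : Fin n₀ → Ω → Obs dβ dg}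
  {b : (Fin n₀ → Obs dβ dg) → EuclideanSpace ℝ (Fin dβ)} {η₀ γ₀ a : ℝ}

theorem isUnit_det_gram (hG : ((popG μ)ᵀ * popG μ).PosDef) (hQ : (popQ μ).PosDef) :
    IsUnit ((popG μ)ᵀ * popW μ * popG μ).det :=
  (posDef_transpose_mul_mul hG hQ.inv).isUnit.map Matrix.detMonoidHom

/-- The preconditioners converge almost surely. -/
theorem ae_tendsto_samplePrecond (hn₀ : 1 ≤ n₀) (hS_meas : ∀ i, Measurable (S i))
    (hS_law : ∀ i, P.map (S i) = μ) (h_indep : iIndepFun S P)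
    (hG : ((popG μ)ᵀ * popG μ).PosDef)
    (hz : Integrable (fun D : Obs dβ dg => ‖D.z‖ ^ 2) μ) (hQ : (popQ μ).PosDef)
    (hG2 : Integrable (fun D : Obs dβ dg => ‖D.G‖ ^ 2) μ)
    (hη₀ : 0 ≤ η₀) (hW₀ : η₀ = 0 → ∀ᵐ ω ∂P, IsUnit (initQ η₀ fun j => S₀ j ω)) :
    ∀ᵐ ω ∂P, Tendsto (fun k => samplePrecond η₀ γ₀ a b S₀ S k ω) atTop
        (𝓝 (precond (popG μ) (popW μ))) ∧
      ∀ᶠ k in atTop, samplePrecond η₀ γ₀ a b S₀ S k ω * (sampleRun η₀ γ₀ a b S₀ S k ω).Φ = 1 := by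
  have hμ : IsProbabilityMeasure μ :=
    hS_law 0 ▸ Measure.isProbabilityMeasure_map (hS_meas 0).aemeasurable
  have hpos : ∀ᵐ ω ∂P, (initQ η₀ fun j => S₀ j ω).PosDef := by
    rcases hη₀.eq_or_lt with h0 | h0
    · filter_upwards [hW₀ h0.symm] with ω hω using posDef_initQ _ hη₀ fun _ => hω
    · exact Eventually.of_forall fun ω => posDef_initQ _ hη₀ fun h => absurd h h0.ne'
  filter_upwards [hpos,
    ae_tendsto_runningMean_matrix (S₀ := S₀) hS_meas hS_law h_indep measurable_G
      fun i j => (memLp_G_apply hG2 i j).integrable one_le_two,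
    ae_tendsto_runningMean_matrix (S₀ := S₀) hS_meas hS_law h_indep measurable_zz
      fun i j => integrable_zz_apply hz i j] with ω hω hΦ hzz
  have hΦ' : Tendsto (fun k => (sampleRun η₀ γ₀ a b S₀ S k ω).Φ) atTop (𝓝 (popG μ)) := by
    simp only [sampleRun, run_Φ _ _ _ hn₀]
    exact hΦ
  have hinv : Tendsto (fun k : ℕ => (((n₀ : ℝ) + k)⁻¹ * (n₀ * η₀)) •
      (1 : Matrix (Fin dg) (Fin dg) ℝ)) atTop (𝓝 0) := by
    have h1 : Tendsto (fun k : ℕ => ((n₀ : ℝ) + k)⁻¹) atTop (𝓝 0) :=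
      tendsto_inv_atTop_zero.comp
        (tendsto_atTop_add_const_left _ _ tendsto_natCast_atTop_atTop)
    simpa using (h1.mul_const ((n₀ : ℝ) * η₀)).smul_const (1 : Matrix (Fin dg) (Fin dg) ℝ)
  have hQ' : Tendsto (fun k => runQ (fun j => S₀ j ω) (fun i => S i ω) η₀ k) atTop
      (𝓝 (popQ μ)) := by
    have := hzz.add hinv
    rw [add_zero] at this
    exact this
  have hW' : Tendsto (fun k => (sampleRun η₀ γ₀ a b S₀ S k ω).W) atTop (𝓝 (popW μ)) := by
    simp only [sampleRun, run_W _ _ _ hn₀ hω]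
    exact tendsto_matrix_inv hQ' (hQ.isUnit.map Matrix.detMonoidHom)
  exact tendsto_precond hΦ' hW' (isUnit_det_gram hG hQ)

/-- The averaged errors of the algorithm are asymptotically linear. -/
theorem tendstoInMeasure_sum_error (hn₀ : 1 ≤ n₀)
    (hS_meas : ∀ i, Measurable (S i)) (hS₀_meas : ∀ j, Measurable (S₀ j))
    (hS_law : ∀ i, P.map (S i) = μ) (hS₀_law : ∀ j, P.map (S₀ j) = μ)
    (h_indep : iIndepFun (Sum.elim S₀ S) P)
    (hG : ((popG μ)ᵀ * popG μ).PosDef)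
    (hz : Integrable (fun D : Obs dβ dg => ‖D.z‖ ^ 2) μ) (hQ : (popQ μ).PosDef)
    {βstar : EuclideanSpace ℝ (Fin dβ)} (hβstar : ∫ D, D.g βstar ∂μ = 0)
    (hγ₀ : 0 < γ₀) (ha : 0 < a) (ha' : a < 1)
    (hG2 : Integrable (fun D : Obs dβ dg => ‖D.G‖ ^ 2) μ)
    (hg2 : Integrable (fun D : Obs dβ dg => ‖D.g βstar‖ ^ 2) μ)
    (hη₀ : 0 ≤ η₀) (hW₀ : η₀ = 0 → ∀ᵐ ω ∂P, IsUnit (initQ η₀ fun j => S₀ j ω))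
    (hb : Measurable b) :
    TendstoInMeasure P (fun (n : ℕ) ω => (√(n : ℝ))⁻¹ • ∑ k ∈ Finset.range n,
      ((sampleRun η₀ γ₀ a b S₀ S (k + 1) ω).β - βstar +
        toCLM (precond (popG μ) (popW μ)) ((S k ω).g βstar))) atTop (fun _ => 0) := by
  have hμ : IsProbabilityMeasure μ :=
    hS_law 0 ▸ Measure.isProbabilityMeasure_map (hS_meas 0).aemeasurable
  have hindS : iIndepFun S P := h_indep.precomp (g := Sum.inr) Sum.inr_injective
  set G := popG μ with hGdef
  set B₀ := precond G (popW μ) with hB₀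
  set Φ : ℕ → Ω → Matrix (Fin dg) (Fin dβ) ℝ := fun k ω => (sampleRun η₀ γ₀ a b S₀ S k ω).Φ with hΦ
  set B : ℕ → Ω → Matrix (Fin dβ) (Fin dg) ℝ := samplePrecond η₀ γ₀ a b S₀ S with hB
  have hlim : ∀ᵐ ω ∂P, Tendsto (fun k => B k ω) atTop (𝓝 B₀) ∧
      ∀ᶠ k in atTop, B k ω * Φ k ω = 1 := ae_tendsto_samplePrecond (γ₀ := γ₀) (a := a) (b := b) hn₀ hS_meas hS_law hindS hG hz
    hQ hG2 hη₀ hW₀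
  have hB₀G : B₀ * G = 1 := precond_mul (isUnit_det_gram hG hQ)
  have hrun : ∀ k, Measurable[past S₀ S k] (fun ω => (sampleRun η₀ γ₀ a b S₀ S k ω).β) ∧
      Measurable[past S₀ S k] (Φ k) ∧
      Measurable[past S₀ S k] (fun ω => (sampleRun η₀ γ₀ a b S₀ S k ω).W) := fun k => by
    have := @measurable_run Ω (past S₀ S k) dβ dg n₀ η₀ γ₀ a S₀ S b
      (measurable_past_init S₀ S k) hb k fun i hi => measurable_past S₀ S hi
    exact ⟨this.1, this.2.1, this.2.2.1⟩
  have hBm : ∀ k, Measurable[past S₀ S k] (B k) := fun k =>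
    @measurable_precond Ω (past S₀ S k) dg dβ _ _ (hrun k).2.1 (hrun k).2.2
  -- the good events
  set c : ℝ := (2 * (‖G‖ + 1))⁻¹ with hc
  have hc0 : 0 < c := by positivity
  have hcG : c * ‖G‖ ≤ 1 / 2 := by
    rw [hc, inv_mul_le_iff₀ (by positivity)]
    linarith
  set good : ℕ → Set Ω := fun k => {ω | ‖B k ω - B₀‖ ≤ c ∧ B k ω * Φ k ω = 1} with hgood
  -- Good events are decided by the past, so the modified preconditioners remain independent of the
  -- next observation.
  have hgoodm : ∀ k, MeasurableSet[past S₀ S k] (good k) := fun k => by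
    have hn : Measurable fun A : Matrix (Fin dβ) (Fin dg) ℝ => ‖A - B₀‖ :=
      (measurable_id.sub_const B₀).norm
    have h1 : MeasurableSet[past S₀ S k] {ω | ‖B k ω - B₀‖ ≤ c} :=
      (hn.comp (hBm k)) measurableSet_Iic
    have h2 : MeasurableSet[past S₀ S k] {ω | B k ω * Φ k ω = 1} :=
      (@measurable_matrix_mul Ω (past S₀ S k) dβ dg dβ _ _ (hBm k) (hrun k).2.1)
        (measurableSet_singleton 1)
    exact h1.inter h2
  have hgoodm' : ∀ k, MeasurableSet (good k) := fun k =>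
    past_le hS₀_meas hS_meas k _ (hgoodm k)
  have hgoodev : ∀ᵐ ω ∂P, ∀ᶠ k in atTop, ω ∈ good k := by
    filter_upwards [hlim] with ω hω
    have h1 : Tendsto (fun k => ‖B k ω - B₀‖) atTop (𝓝 0) := by
      simpa using (hω.1.sub_const B₀).norm
    filter_upwards [h1.eventually_le_const hc0, hω.2] with k h2 h3 using ⟨h2, h3⟩
  classical
  -- the preconditioners, modified off the good events
  set B' : ℕ → Ω → Matrix (Fin dβ) (Fin dg) ℝ := fun k ω => if ω ∈ good k then B k ω else B₀
    with hB'
  have hB'm : ∀ k, Measurable[past S₀ S k] (B' k) := fun k =>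
    Measurable.ite (hgoodm k) (hBm k) measurable_const
  have hB'c : ∀ k ω, ‖B' k ω - B₀‖ ≤ c := fun k ω => by
    by_cases h : ω ∈ good k
    · simpa [hB', h] using h.1
    · simpa [hB', h] using hc0.le
  set K : ℝ := ‖B₀‖ + c with hK
  have hB'K : ∀ k ω, ‖B' k ω‖ ≤ K := fun k ω => by
    have := norm_le_insert' (B' k ω) B₀
    linarith [hB'c k ω]
  -- As `B₀G = 1`, the difference is `(B' - B₀)G`, and `c` is chosen to make it small.
  have hB'G : ∀ k ω, ‖B' k ω * G - 1‖ ≤ 1 / 2 := fun k ω => by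
    rw [← hB₀G, ← Matrix.sub_mul]
    refine (norm_mul_le' _ _).trans (le_trans ?_ hcG)
    gcongr
    exact hB'c k ω
  -- On a good event `BΦ = 1` turns the left side into `B(G - Φ)`; off it, `B₀G = 1` leaves nothing.
  have hB'Φ : ∀ k ω, ‖B' k ω * G - 1‖ ≤ K * ‖Φ k ω - G‖ := fun k ω => by
    by_cases h : ω ∈ good k
    · have e : B' k ω = B k ω := by simp [hB', h]
      have h2 : B' k ω * G - 1 = B' k ω * (G - Φ k ω) := by
        rw [e, Matrix.mul_sub, h.2]
      rw [h2, norm_sub_rev]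
      refine (norm_mul_le' _ _).trans ?_
      gcongr
      exact hB'K k ω
    · have e : B' k ω = B₀ := by simp [hB', h]
      rw [e, hB₀G, sub_self, norm_zero]
      positivity
  have hB'lim : ∀ᵐ ω ∂P, Tendsto (fun k => B' k ω) atTop (𝓝 B₀) := by
    filter_upwards [hlim, hgoodev] with ω h1 h2
    refine h1.1.congr' (h2.mono fun k hk => ?_)
    simp [hB', hk, hB]
  obtain ⟨c₁, hc₁, hΦ2⟩ := exists_lintegral_runningMean_G_le hn₀ hS_meas hS₀_meas hS_law hS₀_law
    h_indep hG2
  have hB'2 : ∀ k : ℕ, ∫⁻ ω, ‖toCLM (B' k ω) ∘L toCLM G - .id ℝ _‖ₑ ^ 2 ∂P ≤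
      ENNReal.ofReal (K ^ 2 * c₁ / ((k : ℝ) + 1)) := fun k => by
    calc _ ≤ ∫⁻ ω, ENNReal.ofReal (K ^ 2) *
          ‖runningMean (fun j => S₀ j ω) (fun i => S i ω) Obs.G k - G‖ₑ ^ 2 ∂P := by
          refine lintegral_mono fun ω => ?_
          rw [← toCLM_mul, ← toCLM_one, ← map_sub, enorm_sq_eq_ofReal, norm_toCLM,
            enorm_sq_eq_ofReal, ← ENNReal.ofReal_mul (by positivity), ← mul_pow]
          refine ENNReal.ofReal_le_ofReal ?_
          have := hB'Φ k ω
          simp only [hΦ, sampleRun, run_Φ _ _ _ hn₀] at this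
          gcongr
      _ = ENNReal.ofReal (K ^ 2) * ∫⁻ ω,
          ‖runningMean (fun j => S₀ j ω) (fun i => S i ω) Obs.G k - G‖ₑ ^ 2 ∂P :=
          lintegral_const_mul' _ _ ENNReal.ofReal_ne_top
      _ ≤ ENNReal.ofReal (K ^ 2) * ENNReal.ofReal (c₁ / ((k : ℝ) + 1)) := by
          gcongr
          exact hΦ2 k
      _ = _ := by rw [← ENNReal.ofReal_mul (by positivity), mul_div_assoc]
  -- the learning rates
  set γ : ℕ → ℝ := fun k => γ₀ * (1 + (k : ℝ)) ^ (-a) with hγdef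
  have hγ : IsLearningRate γ := isLearningRate_rpow hγ₀ ha ha' le_rfl
  set τ := ∫ D : Obs dβ dg, ‖toCLM D.G - toCLM G‖ ^ 2 ∂μ with hτ
  have hτ0 : 0 ≤ τ := integral_nonneg fun _ => by positivity
  have hev : ∀ᶠ N in atTop, ∀ k, N ≤ k → γ k ≤ 1 ∧ γ k * (1 / 4 + 2 * K ^ 2 * τ) ≤ 1 / 4 ∧
      (γ (k + 1))⁻¹ - (γ k)⁻¹ ≤ 1 / 4 := by
    refine eventually_forall_ge_atTop.2 (Eventually.and ?_ (Eventually.and ?_ ?_))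
    · exact hγ.tendsto_zero.eventually_le_const one_pos
    · have := hγ.tendsto_zero.mul_const (1 / 4 + 2 * K ^ 2 * τ)
      rw [zero_mul] at this
      exact this.eventually_le_const (by norm_num)
    · exact hγ.tendsto_inv_sub_zero.eventually_le_const (by norm_num)
  refine tendstoInMeasure_zero_of_localization fun ε hε => ?_
  have hε2 : 0 < ε / 2 := ENNReal.half_pos hε.ne'
  -- From time `N` on the learning rates are small, and with probability at least `1 - ε/2` all
  -- later events are good.
  obtain ⟨N, hN1, hN2⟩ := (hev.and (exists_measure_compl_le (P := P)
    (A := fun n => {ω | ∀ k, n ≤ k → ω ∈ good k})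
    (fun n => by
      simp only [Set.ofPred_forall]
      exact MeasurableSet.iInter fun k => MeasurableSet.iInter fun _ => hgoodm' k)
    (hgoodev.mono fun ω hω => eventually_forall_ge_atTop.2 hω) hε2)).exists
  set δ : ℕ → Ω → EuclideanSpace ℝ (Fin dβ) := fun k ω =>
    (sampleRun η₀ γ₀ a b S₀ S k ω).β - βstar with hδ
  have hδm : ∀ k, Measurable[past S₀ S k] (δ k) := fun k => (hrun k).1.sub_const βstar
  -- The initial estimate need not have moments, so the error at time `N` is truncated at a level
  -- exceeded with probability at most `ε/2`.
  obtain ⟨M, hM⟩ := (exists_measure_compl_le (P := P) (A := fun M : ℕ => {ω | ‖δ N ω‖ ≤ M})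
    (fun M => measurableSet_le ((hδm N).mono (past_le hS₀_meas hS_meas N) le_rfl).norm
      measurable_const)
    (Eventually.of_forall fun ω =>
      (tendsto_natCast_atTop_atTop (R := ℝ)).eventually_ge_atTop (‖δ N ω‖)) hε2).exists
  set T : Obs dβ dg → EuclideanSpace ℝ (Fin dβ) →L[ℝ] EuclideanSpace ℝ (Fin dg) :=
    fun D => toCLM D.G with hT
  set e : Obs dβ dg → EuclideanSpace ℝ (Fin dg) := fun D => D.g βstar with he
  set δ' := errorProcess (fun k => S (N + k)) T e (fun k => γ (N + k))
    (fun k ω => toCLM (B' (N + k) ω)) (fun ω => if ‖δ N ω‖ ≤ M then δ N ω else 0) with hδ'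
  have hδ0 : Measurable[past S₀ S N] fun ω => if ‖δ N ω‖ ≤ M then δ N ω else 0 :=
    Measurable.ite ((measurable_norm.comp (hδm N)) measurableSet_Iic) (hδm N) measurable_const
  have hscheme : IsScheme P (fun k => past S₀ S (N + k)) (fun k => S (N + k)) μ T (toCLM G) e
      (fun k => γ (N + k)) (fun k ω => toCLM (B' (N + k) ω)) δ' :=
    { le := fun k => past_le hS₀_meas hS_meas _
      mono := fun i j hij => past_mono S₀ S (by lia)
      measurable_obs := fun k => measurable_past S₀ S (by lia)
      law := fun k => hS_law _
      indep := fun k => indep_past hS₀_meas hS_meas h_indep _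
      measurable_T := measurable_toCLM.comp measurable_G
      measurable_e := measurable_g βstar
      memLp_T := memLp_toCLM_G hG2
      memLp_e := memLp_two_of_integrable_norm_sq (measurable_g βstar).aestronglyMeasurable hg2
      integral_T := integral_toCLM_G hG2
      integral_e := hβstar
      measurable_B := fun k => measurable_toCLM.comp (hB'm _)
      measurable_zero := hδ0
      step := fun k ω => rfl }
  have hγN : IsLearningRate fun k => γ (N + k) := by
    have := isLearningRate_rpow hγ₀ ha ha' (c := 1 + N) (by linarith [N.cast_nonneg (α := ℝ)])
    simpa only [hγdef, Nat.cast_add, ← add_assoc] using this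
  have hmain := hscheme.tendstoInMeasure (K := K) (M := M) (D := K ^ 2 * c₁) (B₀ := toCLM B₀) hγN
    (fun k ω => by rw [norm_toCLM]; exact hB'K _ ω)
    (by rw [norm_toCLM, hK]; linarith)
    (by
      filter_upwards [hB'lim] with ω hω
      exact (toCLM.continuous.tendsto B₀).comp
        (hω.comp (tendsto_atTop_mono (fun k => Nat.le_add_left k N) tendsto_id)))
    (fun k ω => by
      rw [← toCLM_mul, ← toCLM_one, ← map_sub, norm_toCLM]
      exact hB'G _ ω)
    (fun k => (hN1 _ (by lia)).1) (fun k => (hN1 _ (by lia)).2.1)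
    (fun k => (hN1 (N + k) (by lia)).2.2)
    (fun ω => by
      change ‖if ‖δ N ω‖ ≤ M then δ N ω else 0‖ ≤ (M : ℝ)
      split_ifs with h
      · exact h
      · simp)
    (by positivity)
    (fun k => (hB'2 (N + k)).trans (ENNReal.ofReal_le_ofReal
      (div_le_div_of_nonneg_left (by positivity) (by positivity)
        (by push_cast; linarith [N.cast_nonneg (α := ℝ)]))))
  refine ⟨{ω | ∀ k, N ≤ k → ω ∈ good k} ∩ {ω | ‖δ N ω‖ ≤ M}, N,
    fun ω => ‖∑ k ∈ Finset.range N, (δ (k + 1) ω + toCLM B₀ (e (S k ω)))‖, _, ?_, ?_, hmain, ?_⟩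
  · rw [Set.compl_inter]
    calc _ ≤ ε / 2 + ε / 2 := (measure_union_le _ _).trans (add_le_add hN2 hM)
      _ = ε := ENNReal.add_halves ε
  · have h1 : ∀ k, Measurable (δ k) := fun k => (hδm k).mono (past_le hS₀_meas hS_meas k) le_rfl
    have h2 : ∀ k, Measurable fun ω => toCLM B₀ (e (S k ω)) := fun k =>
      (toCLM B₀).continuous.measurable.comp ((measurable_g βstar).comp (hS_meas k))
    fun_prop
  · rintro n hn ω ⟨hω1, hω2⟩
    -- On the chosen event neither the truncation nor the modification acts, so the scheme
    -- reproduces the algorithm.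
    have heq : ∀ k, δ' k ω = δ (N + k) ω := by
      intro k
      induction k with
      | zero =>
        change (if ‖δ N ω‖ ≤ M then δ N ω else 0) = δ N ω
        exact if_pos hω2
      | succ k ih =>
        have h1 : B' (N + k) ω = B (N + k) ω := by
          simp [hB', hω1 (N + k) (by lia)]
        rw [hscheme.step, ih, h1]
        have h2 := g_add (S (N + k) ω) βstar (δ (N + k) ω)
        simp only [hδ, add_sub_cancel] at h2
        have h3 := run_β_succ (η₀ := η₀) (γ₀ := γ₀) (a := a) (fun j => S₀ j ω)
          (b fun j => S₀ j ω) (fun i => S i ω) (N + k)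
        simp only [hδ, ← add_assoc]
        change _ = (run η₀ γ₀ a (fun j => S₀ j ω) (b fun j => S₀ j ω) (fun i => S i ω)
          (N + k + 1)).β - βstar
        rw [h3, sub_right_comm, hT, he]
        dsimp only
        rw [← h2, hγdef]
        dsimp only
        rw [add_comm (1 : ℝ)]
        rfl
    obtain ⟨m, rfl⟩ := Nat.exists_eq_add_of_le hn
    rw [Finset.sum_range_add, smul_add, Nat.add_sub_cancel_left]
    refine (norm_add_le _ _).trans (add_le_add ?_ ?_)
    · rw [norm_smul, Real.norm_of_nonneg (by positivity)]
    · have hsum : ∑ k ∈ Finset.range m, (δ' (k + 1) ω + toCLM B₀ (e (S (N + k) ω))) =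
          ∑ k ∈ Finset.range m, (δ (N + k + 1) ω + toCLM B₀ (e (S (N + k) ω))) :=
        Finset.sum_congr rfl fun k _ => by rw [heq, add_assoc]
      rw [hsum, norm_smul, norm_smul, Real.norm_of_nonneg (by positivity),
        Real.norm_of_nonneg (by positivity)]
      -- For `m = 0` the inverse root is the default value `0` and cannot dominate `(√N)⁻¹`, but the
      -- sum is empty.
      rcases Nat.eq_zero_or_pos m with rfl | hm
      · simp
      · have : 0 < √(m : ℝ) := Real.sqrt_pos.2 (by exact_mod_cast hm)
        have h5 : √(m : ℝ) ≤ √((N + m : ℕ) : ℝ) :=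
          Real.sqrt_le_sqrt (by push_cast; linarith [N.cast_nonneg (α := ℝ)])
        gcongr

end Main

/-! ### The asymptotic covariance matrix -/

section AsymptoticVariance

variable {dβ dg : ℕ} {μ : Measure (Obs dβ dg)}

/-- The variance of a linear combination of the moment functions. -/
theorem variance_dotProduct_g [IsProbabilityMeasure μ] {β : EuclideanSpace ℝ (Fin dβ)}
    (hg2 : MemLp (fun D : Obs dβ dg => D.g β) 2 μ) (u : Fin dg → ℝ) :
    Var[fun D : Obs dβ dg => u ⬝ᵥ (D.g β).ofLp; μ] = u ⬝ᵥ (popOmega μ β *ᵥ u) := by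
  have hk : ∀ k, MemLp (fun D : Obs dβ dg => D.g β k) 2 μ := fun k =>
    hg2.mono ((EuclideanSpace.proj (𝕜 := ℝ) k).continuous.comp_aestronglyMeasurable hg2.1)
      (Eventually.of_forall fun D => PiLp.norm_apply_le _ k)
  have h := variance_fun_sum (μ := μ) (X := fun k (D : Obs dβ dg) => u k * D.g β k)
    fun k => (hk k).const_mul (u k)
  simp only [dotProduct, Matrix.mulVec]
  rw [h]
  refine Finset.sum_congr rfl fun k _ => ?_
  rw [Finset.mul_sum]
  refine Finset.sum_congr rfl fun l _ => ?_
  rw [covariance_const_mul_left, covariance_const_mul_right]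
  simp only [popOmega, Matrix.of_apply]
  ring

theorem transpose_popOmega (β : EuclideanSpace ℝ (Fin dβ)) :
    (popOmega μ β)ᵀ = popOmega μ β := by
  ext k l
  simp only [Matrix.transpose_apply, popOmega, Matrix.of_apply]
  exact covariance_comm _ _

/-- `W` is symmetric, so the sandwich is the covariance `B₀ΩB₀'` of `B₀ g_i(β_*)`. -/
theorem avar_eq (hG : ((popG μ)ᵀ * popG μ).PosDef) (hQ : (popQ μ).PosDef)
    (β : EuclideanSpace ℝ (Fin dβ)) :
    avar μ β = precond (popG μ) (popW μ) * popOmega μ β * (precond (popG μ) (popW μ))ᵀ := by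
  have hW : (popW μ)ᵀ = popW μ := (by simpa using hQ.inv.isHermitian : (popQ μ)⁻¹.IsSymm)
  rw [precond_eq (isUnit_det_gram hG hQ), Matrix.transpose_mul, Matrix.transpose_mul,
    Matrix.transpose_transpose, Matrix.transpose_nonsing_inv, Matrix.transpose_mul,
    Matrix.transpose_mul, Matrix.transpose_transpose, hW, avar]
  simp only [Matrix.mul_assoc]

/-- The quadratic form of `Ω` is a variance. Semidefiniteness is what gives `multivariateGaussian`
its intended characteristic function. -/
theorem posSemidef_mul_popOmega [IsProbabilityMeasure μ] {β : EuclideanSpace ℝ (Fin dβ)}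
    (hg2 : MemLp (fun D : Obs dβ dg => D.g β) 2 μ) {m : ℕ} (B : Matrix (Fin m) (Fin dg) ℝ) :
    (B * popOmega μ β * Bᵀ).PosSemidef := by
  have h : (popOmega μ β).PosSemidef :=
    .of_dotProduct_mulVec_nonneg (by simpa [Matrix.IsHermitian] using transpose_popOmega β)
      fun u => by
        rw [star_trivial, ← variance_dotProduct_g hg2]
        exact variance_nonneg _ _
  simpa using h.mul_mul_conjTranspose_same B

end AsymptoticVariance

end S2SLS

end

/-! ### The central limit theorem for the averaged iterates -/

theorem theorem1 {Ω : Type*} [MeasurableSpace Ω] (P : Measure Ω) [IsProbabilityMeasure P]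
    {dβ dg n₀ : ℕ} (hd : dβ ≤ dg) (hn₀ : 1 ≤ n₀)
    -- the population distribution of `(x, z, y)`
    (μ : Measure (S2SLS.Obs dβ dg))
    -- the sample and the initialization sample: independent draws from `μ`
    (S : ℕ → Ω → S2SLS.Obs dβ dg) (S₀ : Fin n₀ → Ω → S2SLS.Obs dβ dg)
    (hS_meas : ∀ i, Measurable (S i)) (hS₀_meas : ∀ j, Measurable (S₀ j))
    (hS_law : ∀ i, P.map (S i) = μ) (hS₀_law : ∀ j, P.map (S₀ j) = μ)
    (h_indep : iIndepFun (Sum.elim S₀ S) P)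
    -- identification
    (hG : ((S2SLS.popG μ)ᵀ * S2SLS.popG μ).PosDef)
    (hz : Integrable (fun D : S2SLS.Obs dβ dg => ‖D.z‖ ^ 2) μ)
    (hQ : (S2SLS.popQ μ).PosDef)
    (βstar : EuclideanSpace ℝ (Fin dβ))
    (hβstar : ∀ β : EuclideanSpace ℝ (Fin dβ), ∫ D, D.g β ∂μ = 0 ↔ β = βstar)
    -- learning rate
    (γ₀ a : ℝ) (hγ₀ : 0 < γ₀) (ha : 1 / 2 < a) (ha' : a < 1)
    -- moments
    (hG2 : Integrable (fun D : S2SLS.Obs dβ dg => ‖D.G‖ ^ 2) μ)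
    (hg2 : Integrable (fun D : S2SLS.Obs dβ dg => ‖D.g βstar‖ ^ 2) μ)
    -- initialization: `W₀` exists, and `β₀` is any measurable function of the initial sample
    (η₀ : ℝ) (hη₀ : 0 ≤ η₀)
    (hW₀ : η₀ = 0 → ∀ᵐ ω ∂P, IsUnit (S2SLS.initQ η₀ (fun j => S₀ j ω)))
    (b : (Fin n₀ → S2SLS.Obs dβ dg) → EuclideanSpace ℝ (Fin dβ)) (hb : Measurable b) :
    TendstoInDistribution
      (fun (n : ℕ) (ω : Ω) =>
        √(n : ℝ) • ((S2SLS.run η₀ γ₀ a (fun j => S₀ j ω) (b (fun j => S₀ j ω))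
          (fun i => S i ω) n).βbar - βstar))
      atTop
      (id : EuclideanSpace ℝ (Fin dβ) → EuclideanSpace ℝ (Fin dβ))
      (fun _ => P)
      (multivariateGaussian 0 (S2SLS.avar μ βstar)) := by
  have hg : Measurable fun D : S2SLS.Obs dβ dg => D.g βstar := S2SLS.measurable_g βstar
  have hμ : IsProbabilityMeasure μ :=
    hS_law 0 ▸ Measure.isProbabilityMeasure_map (hS_meas 0).aemeasurable
  have hgL : MemLp (fun D : S2SLS.Obs dβ dg => D.g βstar) 2 μ :=
    S2SLS.memLp_two_of_integrable_norm_sq hg.aestronglyMeasurable hg2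
  have hg0 : ∫ D, D.g βstar ∂μ = 0 := (hβstar βstar).2 rfl
  have hindS : iIndepFun S P := h_indep.precomp (g := Sum.inr) Sum.inr_injective
  set B : Matrix (Fin dβ) (Fin dg) ℝ := S2SLS.precond (S2SLS.popG μ) (S2SLS.popW μ) with hB
  set L : S2SLS.Obs dβ dg → EuclideanSpace ℝ (Fin dβ) := fun D => -S2SLS.toCLM B (D.g βstar)
    with hL
  have hLm : Measurable L := ((S2SLS.toCLM B).continuous.measurable.comp hg).neg
  have hL2 : MemLp L 2 μ := ((S2SLS.toCLM B).comp_memLp' hgL).neg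
  have hclt : TendstoInDistribution
      (fun (n : ℕ) ω => (√(n : ℝ))⁻¹ • ∑ k ∈ Finset.range n, L (S k ω)) atTop
      (id : EuclideanSpace ℝ (Fin dβ) → _) (fun _ => P)
      (multivariateGaussian 0 (S2SLS.avar μ βstar)) := by
    rw [S2SLS.avar_eq hG hQ]
    refine S2SLS.tendstoInDistribution_multivariateGaussian (X := fun k ω => L (S k ω))
      (fun i => hLm.comp (hS_meas i)) ?_ (hindS.comp (fun _ => L) fun _ => hLm)
      (fun i => (S2SLS.identDistrib_of_law (hS_meas i) (hS_meas 0) (hS_law i) (hS_law 0)).comp hLm)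
      ?_ (S2SLS.posSemidef_mul_popOmega hgL B) fun t => ?_
    · exact (by rwa [hS_law 0] : MemLp L 2 (P.map (S 0))).comp_of_map (hS_meas 0).aemeasurable
    · rw [← integral_map (f := L) (hS_meas 0).aemeasurable hLm.aestronglyMeasurable, hS_law 0, hL,
        integral_neg, (S2SLS.toCLM B).integral_comp_comm (hgL.integrable one_le_two), hg0, map_zero,
        neg_zero]
    · have h1 : Var[fun ω => inner ℝ (L (S 0 ω)) t; P] = Var[fun D => inner ℝ (L D) t; μ] := by
        have hm : Measurable fun D => inner ℝ (L D) t := hLm.inner measurable_const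
        rw [← hS_law 0, variance_map hm.aemeasurable (hS_meas 0).aemeasurable]
        rfl
      have h2 : ∀ D : S2SLS.Obs dβ dg, inner ℝ (L D) t =
          (-(Bᵀ *ᵥ t.ofLp)) ⬝ᵥ (D.g βstar).ofLp := fun D => by
        rw [hL, inner_neg_left, EuclideanSpace.inner_eq_star_dotProduct, star_trivial,
          S2SLS.toCLM_apply, neg_dotProduct, Matrix.mulVec_transpose, ← Matrix.dotProduct_mulVec]
      rw [h1]
      simp_rw [h2]
      rw [S2SLS.variance_dotProduct_g hgL, Matrix.mulVec_neg, neg_dotProduct_neg,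
        Matrix.mulVec_transpose, ← Matrix.dotProduct_mulVec, ← Matrix.mulVec_transpose,
        Matrix.mulVec_mulVec, Matrix.mulVec_mulVec, Matrix.mul_assoc]
  have hrem := S2SLS.tendstoInMeasure_sum_error (η₀ := η₀) hn₀ hS_meas hS₀_meas hS_law hS₀_law h_indep
    hG hz hQ hg0 hγ₀ (by linarith) ha' hG2 hg2 hη₀ hW₀ hb
  -- Slutsky: the scaled error differs from the normalized sum of `L` by the remainder `hrem`,
  -- because `√n • β̄_n = (√n)⁻¹ • ∑ β_k`, also at `n = 0`.
  refine tendstoInDistribution_of_tendstoInMeasure_sub _ _ hclt ?_ fun n => ?_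
  · refine hrem.congr_left fun n => Eventually.of_forall fun ω => ?_
    have h1 := S2SLS.smul_run_βbar (η₀ := η₀) (γ₀ := γ₀) (a := a) (fun j => S₀ j ω)
      (b fun j => S₀ j ω) (fun i => S i ω) n
    have h2 : √(n : ℝ) = (√(n : ℝ))⁻¹ * n := by
      rcases Nat.eq_zero_or_pos n with rfl | hn
      · simp
      · have : 0 < √(n : ℝ) := Real.sqrt_pos.2 (by exact_mod_cast hn)
        field_simp
        exact Real.sq_sqrt n.cast_nonneg
    simp only [Pi.sub_apply, hL, Finset.sum_neg_distrib, smul_neg, sub_neg_eq_add]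
    nth_rewrite 2 [h2]
    rw [mul_smul, ← smul_add, smul_sub, h1, Finset.sum_add_distrib, Finset.sum_sub_distrib,
      Finset.sum_const, Finset.card_range, Nat.cast_smul_eq_nsmul]
    rfl
  · have := (S2SLS.measurable_run (η₀ := η₀) (γ₀ := γ₀) (a := a) hS₀_meas hb n
      fun i _ => hS_meas i).2.2.2
    exact ((this.sub_const βstar).fun_const_smul _).aemeasurable
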